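/- Setting. Let $\mathcal O\subseteq\mathbb R^d$ be a Borel set, $\mathcal B_b(\mathcal O)$ the $\delta$-ring of Borel subsets of $\mathcal O$ whose closure in $\mathcal O$ is compact, $\zeta$ a locally finite Borel measure on $\mathcal O$, $1\le p<\infty$ and $p'=p/(p-1)$ (so $p'=\infty$ if $p=1$). Let $(\Omega,\mathcal A,P)$ be a probability space and let $L^0(\Omega,P)$ carry convergence in probability. A cylindrical Lévy process $L$ in $L^p(\mathcal O,\zeta)$ is a family $(L(t))_{t\ge0}$ of continuous linear maps $L(t)\colon L^{p'}(\mathcal O,\zeta)\to L^0(\Omega,P)$ such that $(L(t)f_1,\dots,L(t)f_n)_{t\ge 0}$ is a Lévy process in $\mathbb R^n$ (it starts at $0$, has independent and stationary increments and is stochastically continuous) for all $n$ and $f_1,\dots,f_n\in L^{p'}(\mathcal O,\zeta)$. Its symbol is the function $\Psi_L\colon L^{p'}(\mathcal O,\zeta)\to\mathbb C$ with $E[e^{iL(t)f}]=e^{t\Psi_L(f)}$ for all $t\ge0$ and all $f$. The process $L$ is independently scattered if $L(t)1_{A_1},\dots,L(t)1_{A_n}$ are independent for all $t\ge0$, $n\in\mathbb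 N$ and pairwise disjoint $A_1,\dots,A_n\in\mathcal B_b(\mathcal O)$. Say that $\Psi_L$ is of the form $(*)$ if there are a signed measure $\gamma$ on $\mathcal B_b(\mathcal O)$, a measure $\Sigma$ on $\mathcal B_b(\mathcal O)$ (finite there, and extended to the Borel sets of $\mathcal O$) and a $\sigma$-finite measure $\nu$ on $\mathcal B(\mathcal O\times\mathbb R)$ such that $\nu(B\times\cdot)$ is a Lévy measure on $\mathbb R$ for each $B\in\mathcal B_b(\mathcal O)$, and such that for each measurable $f$ with $f\in L^{p'}(\mathcal O,\zeta)$ one has $\int_{\mathcal O} f^2\,d\Sigma<\infty$ and $$\Psi_L(f)=i\int_{\mathcal O}f(x)\,\gamma(dx)-\tfrac12\int_{\mathcal O}f(x)^2\,\Sigma(dx)+\int_{\mathcal O\times\mathbb R}\big(e^{if(x)y}-1-if(x)y1_{\{|y|\le1\}}\big)\,\nu(dx,dy).\qquad(*)$$ Here the sum of the first and the third integral is understood as one integral in $x$, namely as the limit of $$i\int_{A}f\,d\gamma+\int_{A\times\mathbb R}\big(e^{if(x)y}-1-if(x)y1_{\{|y|\le1\}}\big)\,\nu(dx,dy)$$ along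 the sets $A\in\mathcal B_b(\mathcal O)$ on which $f$ is bounded, directed by inclusion (both integrals converge absolutely for each such $A$), and the existence of the limit is part of $(*)$. Theorem. Let $L$ be a cylindrical Lévy process in $L^p(\mathcal O,\zeta)$. (a) If $1<p<\infty$, then $L$ is independently scattered if and only if its symbol is of the form $(*)$. (b) If $p=1$, then $L$ is independently scattered whenever its symbol is of the form $(*)$. -/

import Mathlib

open MeasureTheory ProbabilityTheory Filter Topology
open scoped ENNReal NNReal

noncomputable section

namespace CylLevy

/-! ### Lévy processes and cylindrical Lévy processes -/

section Processes

variable {Ω : Type*} [MeasurableSpace Ω]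

/-- A Lévy process in `ℝⁿ` under `P`: it starts at `0`, has independent and stationary increments
and is stochastically continuous. The members are random variables up to almost sure equality,
so no regularity of paths is demanded (a càdlàg modification always exists). -/
structure IsLevyProcess (P : Measure Ω) {n : ℕ} (X : ℝ≥0 → Ω → (Fin n → ℝ)) : Prop where
  aemeasurable : ∀ t, AEMeasurable (X t) P
  zero : ∀ᵐ ω ∂P, X 0 ω = 0
  indep : HasIndepIncrements X P
  stationary : ∀ s t : ℝ≥0,
    IdentDistrib (fun ω => X (s + t) ω - X s ω) (fun ω => X t ω - X 0 ω) P P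
  stochContinuous : ∀ t, TendstoInMeasure P X (𝓝 t) (X t)

variable {X : Type*} [MeasurableSpace X]

/-- A family `(L(t) : t ≥ 0)` of linear maps from the dual space `F* = L^q(ζ)` of `F = L^p(ζ)`
(where `1/p + 1/q = 1`) to `L⁰(Ω, P)` is a cylindrical Lévy process in `F` if each `L(t)` is
continuous, where `L⁰(Ω, P)` carries convergence in probability, and if
`(L(t) f₁, …, L(t) fₙ)`, `t ≥ 0`, is a Lévy process in `ℝⁿ` for all `f₁, …, fₙ ∈ F*`. -/
structure IsCylindricalLevyProcess (P : Measure Ω) (ζ : Measure X) (q : ℝ≥0∞) [Fact (1 ≤ q)]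
    (L : ℝ≥0 → Lp ℝ q ζ →ₗ[ℝ] (Ω →ₘ[P] ℝ)) : Prop where
  continuous : ∀ t (f : Lp ℝ q ζ),
    TendstoInMeasure P (fun (g : Lp ℝ q ζ) (ω : Ω) => L t g ω) (𝓝 f) (fun ω => L t f ω)
  levy : ∀ (n : ℕ) (f : Fin n → Lp ℝ q ζ),
    IsLevyProcess P (fun (t : ℝ≥0) (ω : Ω) (k : Fin n) => L t (f k) ω)

/-- `Ψ` is the symbol of `L`: the characteristic function of `L(t)` is `f ↦ exp (t Ψ(f))` for
every `t ≥ 0`. There is at most one such `Ψ`. -/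
def IsSymbol (P : Measure Ω) (ζ : Measure X) (q : ℝ≥0∞) [Fact (1 ≤ q)]
    (L : ℝ≥0 → Lp ℝ q ζ →ₗ[ℝ] (Ω →ₘ[P] ℝ)) (Ψ : Lp ℝ q ζ → ℂ) : Prop :=
  ∀ (t : ℝ≥0) (f : Lp ℝ q ζ),
    ∫ ω, Complex.exp (Complex.I * ((L t f ω : ℝ) : ℂ)) ∂P = Complex.exp (((t : ℝ) : ℂ) * Ψ f)

end Processes

/-! ### The `δ`-ring of relatively compact Borel sets -/

section Sets

variable {X : Type*} [TopologicalSpace X] [MeasurableSpace X]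

/-- `A` belongs to the `δ`-ring of relatively compact Borel subsets of `X`. -/
def IsRelCompactBorel (A : Set X) : Prop :=
  MeasurableSet A ∧ IsCompact (closure A)

theorem IsRelCompactBorel.measure_ne_top {A : Set X} (hA : IsRelCompactBorel A)
    (ζ : Measure X) [IsLocallyFiniteMeasure ζ] : ζ A ≠ ∞ :=
  ((measure_mono subset_closure).trans_lt hA.2.measure_lt_top).ne

theorem IsRelCompactBorel.inter_left [T2Space X] {A B : Set X} (hA : IsRelCompactBorel A)
    (hB : MeasurableSet B) : IsRelCompactBorel (A ∩ B) :=
  ⟨hA.1.inter hB, hA.2.of_isClosed_subset isClosed_closure (closure_mono Set.inter_subset_left)⟩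

/-- The indicator function of a relatively compact Borel set as an element of `L^q(ζ)`. -/
def indicatorLp (ζ : Measure X) [IsLocallyFiniteMeasure ζ] (q : ℝ≥0∞) {A : Set X}
    (hA : IsRelCompactBorel A) : Lp ℝ q ζ :=
  indicatorConstLp q hA.1 (hA.measure_ne_top ζ) (1 : ℝ)

/-- `L` is independently scattered: for pairwise disjoint relatively compact Borel sets
`A₁, …, Aₙ` and every `t ≥ 0` the random variables `L(t) 1_{A₁}, …, L(t) 1_{Aₙ}` are
independent. -/
def IsIndependentlyScattered {Ω : Type*} [MeasurableSpace Ω] (P : Measure Ω)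
    (ζ : Measure X) [IsLocallyFiniteMeasure ζ] (q : ℝ≥0∞) [Fact (1 ≤ q)]
    (L : ℝ≥0 → Lp ℝ q ζ →ₗ[ℝ] (Ω →ₘ[P] ℝ)) : Prop :=
  ∀ (n : ℕ) (A : Fin n → Set X) (hA : ∀ k, IsRelCompactBorel (A k)),
    Pairwise (fun j k => Disjoint (A j) (A k)) →
    ∀ t : ℝ≥0, iIndepFun (fun (k : Fin n) (ω : Ω) => L t (indicatorLp ζ q (hA k)) ω) P

/-! ### Characteristics -/

/-- A signed measure on the `δ`-ring of relatively compact Borel sets: a real-valued set function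
that is countably additive on that `δ`-ring. It may have infinite total variation on all of `X`.
The values on other sets are irrelevant. -/
structure LocalSignedMeasure (X : Type*) [TopologicalSpace X] [MeasurableSpace X] where
  toFun : Set X → ℝ
  empty : toFun ∅ = 0
  hasSum_iUnion : ∀ A : ℕ → Set X, (∀ i, IsRelCompactBorel (A i)) →
    Pairwise (fun i j => Disjoint (A i) (A j)) → IsRelCompactBorel (⋃ i, A i) →
    HasSum (fun i => toFun (A i)) (toFun (⋃ i, A i))

/-- The finite signed measure `B ↦ γ (A ∩ B)`, for a relatively compact Borel set `A`. -/
def LocalSignedMeasure.restrict [T2Space X] (γ : LocalSignedMeasure X) {A : Set X}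
    (hA : IsRelCompactBorel A) : SignedMeasure X := by
  classical
  exact
  { measureOf' := fun B => if MeasurableSet B then γ.toFun (A ∩ B) else 0
    empty' := by simp [γ.empty]
    not_measurable' := fun B hB => by simp [hB]
    m_iUnion' := fun B hB hd => by
      have h := γ.hasSum_iUnion (fun i => A ∩ B i) (fun i => hA.inter_left (hB i))
        (fun i j hij => (hd hij).mono Set.inter_subset_right Set.inter_subset_right)
        (by rw [← Set.inter_iUnion]; exact hA.inter_left (MeasurableSet.iUnion hB))
      rw [← Set.inter_iUnion] at h
      simpa [hB, MeasurableSet.iUnion hB] using h }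

theorem LocalSignedMeasure.restrict_apply [T2Space X] (γ : LocalSignedMeasure X) {A B : Set X}
    (hA : IsRelCompactBorel A) (hB : MeasurableSet B) : γ.restrict hA B = γ.toFun (A ∩ B) := by
  classical
  exact if_pos hB

/-- The integral `∫_A f dγ` over a relatively compact Borel set `A`. -/
def LocalSignedMeasure.setIntegral [T2Space X] (γ : LocalSignedMeasure X) {A : Set X}
    (hA : IsRelCompactBorel A) (f : X → ℝ) : ℝ :=
  VectorMeasure.integral (γ.restrict hA) f (ContinuousLinearMap.lsmul ℝ ℝ)

/-- A Lévy measure on `ℝ`: no mass at `0`, and `∫ (1 ∧ y²) μ(dy) < ∞`. -/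
def IsLevyMeasure (μ : Measure ℝ) : Prop :=
  μ {0} = 0 ∧ ∫⁻ y, ENNReal.ofReal (min 1 (y ^ 2)) ∂μ < ∞

/-- The section `ν(A × ·)` of a measure `ν` on `X × ℝ`. -/
def sectionMeasure (ν : Measure (X × ℝ)) (A : Set X) : Measure ℝ :=
  (ν.restrict (A ×ˢ Set.univ)).map Prod.snd

/-- Characteristics `(γ, Σ, ν)`: a signed measure `γ` and a measure `Σ` on the `δ`-ring of
relatively compact Borel sets (the latter given through its extension to the Borel `σ`-algebra),
and a `σ`-finite measure `ν` on `X × ℝ` whose sections `ν(A × ·)` are Lévy measures. -/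
structure Characteristics (X : Type*) [TopologicalSpace X] [MeasurableSpace X] where
  γ : LocalSignedMeasure X
  gaussian : Measure X
  gaussian_lt_top : ∀ A, IsRelCompactBorel A → gaussian A < ∞
  ν : Measure (X × ℝ)
  sigmaFinite : SigmaFinite ν
  isLevyMeasure : ∀ A, IsRelCompactBorel A → IsLevyMeasure (sectionMeasure ν A)

/-- The integrand `e^{i f(x) y} - 1 - i f(x) y 1_{|y| ≤ 1}`. -/
def jumpIntegrand (f : X → ℝ) (z : X × ℝ) : ℂ :=
  Complex.exp (Complex.I * ((f z.1 * z.2 : ℝ) : ℂ)) - 1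
    - Complex.I * ((f z.1 * z.2 * Set.indicator (Set.Icc (-1 : ℝ) 1) 1 z.2 : ℝ) : ℂ)

/-- The relatively compact Borel sets on which `f` is bounded, directed by inclusion. -/
abbrev BddSets (f : X → ℝ) : Type _ :=
  {A : Set X // IsRelCompactBorel A ∧ ∃ C : ℝ, ∀ x ∈ A, |f x| ≤ C}

/-- `Ψ(f) = i ∫ f dγ - ½ ∫ f² dΣ + ∫ (e^{i f(x) y} - 1 - i f(x) y 1_{|y| ≤ 1}) ν(dx, dy)`
for all `f ∈ L^q(ζ)`.

On a relatively compact Borel set `A` on which `f` is bounded, all three integrals converge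
absolutely. For general `f ∈ L^q(ζ)`, the first and the third integral need not converge
separately over the whole space; it is only their sum, integrated jointly in `x`, that does.
So this sum is the (unconditional) limit of the integrals over such sets `A`, directed by
inclusion. -/
def HasSymbolForm [T2Space X] (ζ : Measure X) (q : ℝ≥0∞) (c : Characteristics X)
    (Ψ : Lp ℝ q ζ → ℂ) : Prop :=
  ∀ (f : X → ℝ) (_ : Measurable f) (hf : MemLp f q ζ),
    Integrable (fun x => f x ^ 2) c.gaussian ∧
    ∃ J : ℂ,
      Tendsto (fun A : BddSets f =>
          Complex.I * ((c.γ.setIntegral A.2.1 f : ℝ) : ℂ)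
            + ∫ z in A.1 ×ˢ Set.univ, jumpIntegrand f z ∂c.ν)
        atTop (𝓝 J) ∧
      Ψ (hf.toLp f) = J - 1 / 2 * ((∫ x, f x ^ 2 ∂c.gaussian : ℝ) : ℂ)

end Sets

end CylLevy

end

namespace CylLevy

/-! ### The symbol -/

section Symbol

theorem exists_eq_exp_of_continuous_semigroup {φ : ℝ≥0 → ℂ} (hc : Continuous φ) (h0 : φ 0 = 1)
    (hadd : ∀ s t, φ (s + t) = φ s * φ t) :
    ∃ z : ℂ, ∀ t : ℝ≥0, φ t = Complex.exp (((t : ℝ) : ℂ) * z) := by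
  set g : ℝ → ℂ := fun t => φ t.toNNReal with hg
  have hgc : Continuous g := hc.comp continuous_real_toNNReal
  have hgadd : ∀ s t : ℝ, 0 ≤ s → 0 ≤ t → g (s + t) = g s * g t := fun s t hs ht => by
    simp only [hg, Real.toNNReal_add hs ht, hadd]
  set F : ℝ → ℂ := fun t => ∫ s in (0 : ℝ)..t, g s with hF
  have hFd : ∀ t, HasDerivAt F (g t) t := fun t =>
    intervalIntegral.integral_hasDerivAt_right (hgc.intervalIntegrable _ _)
      (hgc.stronglyMeasurableAtFilter _ _) hgc.continuousAt
  obtain ⟨ε, hε, hFε⟩ : ∃ ε : ℝ, 0 < ε ∧ F ε ≠ 0 := by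
    by_contra! hcon
    have h1 : HasDerivWithinAt F (g 0) (Set.Ioi 0) 0 := (hFd 0).hasDerivWithinAt
    have h2 : HasDerivWithinAt F 0 (Set.Ioi 0) 0 := by
      refine (hasDerivWithinAt_const 0 (Set.Ioi 0) (0 : ℂ)).congr (fun x hx => hcon x hx) ?_
      simp [hF]
    have h3 := (uniqueDiffWithinAt_Ioi (0 : ℝ)).eq_deriv _ h1 h2
    simp [hg, h0] at h3
  set G : ℝ → ℂ := fun t => (F (t + ε) - F t) / F ε with hG
  have hGg : ∀ t, 0 ≤ t → G t = g t := by
    intro t ht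
    rw [hG]
    simp only
    rw [div_eq_iff hFε]
    simp only [hF]
    rw [intervalIntegral.integral_interval_sub_left (hgc.intervalIntegrable _ _)
      (hgc.intervalIntegrable _ _), ← intervalIntegral.integral_const_mul]
    have : ∫ x in (t : ℝ)..(t + ε), g x = ∫ x in (0 : ℝ)..ε, g (t + x) := by
      rw [intervalIntegral.integral_comp_add_left]; simp
    rw [this]
    refine intervalIntegral.integral_congr fun x hx => ?_
    rw [Set.uIcc_of_le hε.le] at hx
    exact hgadd t x ht hx.1
  set z : ℂ := (g ε - 1) / F ε with hz
  have hGd : ∀ t, 0 ≤ t → HasDerivAt G (z * G t) t := by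
    intro t ht
    have h1 : HasDerivAt G ((g (t + ε) - g t) / F ε) t :=
      (((hFd (t + ε)).comp_add_const t ε).sub (hFd t)).div_const _
    convert h1 using 1
    rw [hGg t ht, hgadd t ε ht hε.le, hz]
    ring
  refine ⟨z, fun t => ?_⟩
  have hH : ∀ s, 0 ≤ s → HasDerivAt (fun s : ℝ => G s * Complex.exp (-(s * z))) 0 s := by
    intro s hs
    have h1 : HasDerivAt (fun s : ℝ => Complex.exp (-((s : ℂ) * z)))
        (Complex.exp (-(s * z)) * (-(1 * z))) s := by
      have : HasDerivAt (fun s : ℝ => (s : ℂ)) 1 s := Complex.ofRealCLM.hasDerivAt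
      exact ((this.mul_const z).neg).cexp
    have h2 : HasDerivAt (fun s : ℝ => G s * Complex.exp (-(s * z)))
        (z * G s * Complex.exp (-(s * z)) + G s * (Complex.exp (-(s * z)) * (-(1 * z)))) s :=
      (hGd s hs).mul h1
    convert h2 using 1
    ring
  have hconst := constant_of_has_deriv_right_zero (a := (0 : ℝ)) (b := t)
    (fun s hs => (hH s hs.1).continuousAt.continuousWithinAt)
    (fun s hs => (hH s hs.1).hasDerivWithinAt) t ⟨t.2, le_rfl⟩
  simp only [Complex.ofReal_zero, zero_mul, neg_zero, Complex.exp_zero, mul_one] at hconst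
  rw [hGg 0 le_rfl, hGg t t.2] at hconst
  simp only [hg, Real.toNNReal_coe, Real.toNNReal_zero, h0] at hconst
  rw [Complex.exp_neg, mul_inv_eq_one₀ (Complex.exp_ne_zero _)] at hconst
  exact hconst

theorem eq_of_forall_exp_mul_eq {a b : ℂ}
    (h : ∀ t : ℝ≥0, Complex.exp (((t : ℝ) : ℂ) * a) = Complex.exp (((t : ℝ) : ℂ) * b)) : a = b := by
  have hd : ∀ c : ℂ, HasDerivWithinAt (fun s : ℝ => Complex.exp ((s : ℂ) * c)) c (Set.Ici 0) 0 := by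
    intro c
    have : HasDerivAt (fun s : ℝ => (s : ℂ)) 1 0 := Complex.ofRealCLM.hasDerivAt
    simpa using ((this.mul_const c).cexp).hasDerivWithinAt (s := Set.Ici 0)
  refine (uniqueDiffOn_Ici (0 : ℝ) 0 Set.self_mem_Ici).eq_deriv _ (hd a) ((hd b).congr ?_ (by simp))
  intro x hx
  exact h ⟨x, hx⟩

theorem tendsto_integral_exp_of_tendstoInMeasure {Ω ι : Type*} [MeasurableSpace Ω] {P : Measure Ω}
    [IsProbabilityMeasure P] {l : Filter ι} [l.IsCountablyGenerated] {Y : ι → Ω → ℝ} {Z : Ω → ℝ}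
    (h : TendstoInMeasure P Y l Z) (hY : ∀ i, AEMeasurable (Y i) P) (hZ : AEMeasurable Z P) :
    Tendsto (fun i => ∫ ω, Complex.exp (Complex.I * (Y i ω : ℂ)) ∂P) l
      (𝓝 (∫ ω, Complex.exp (Complex.I * (Z ω : ℂ)) ∂P)) := by
  have h1 := (h.tendstoInDistribution_of_aemeasurable hY hZ).tendsto
  have h2 := (ProbabilityMeasure.tendsto_iff_forall_integral_rclike_tendsto ℂ).1 h1
    (BoundedContinuousFunction.innerProbChar (1 : ℝ))
  have key : ∀ W : Ω → ℝ, AEMeasurable W P →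
      ∫ x, BoundedContinuousFunction.innerProbChar (1 : ℝ) x ∂(P.map W)
      = ∫ ω, Complex.exp (Complex.I * (W ω : ℂ)) ∂P := by
    intro W hW
    rw [integral_map hW (BoundedContinuousFunction.continuous _).aestronglyMeasurable]
    simp [BoundedContinuousFunction.innerProbChar_apply, mul_comm]
  rw [← key Z hZ]
  simp_rw [← fun i => key (Y i) (hY i)]
  exact h2

variable {Ω X : Type*} [MeasurableSpace Ω] [MeasurableSpace X] {P : Measure Ω}
  {ζ : Measure X} {q : ℝ≥0∞}
  {L : ℝ≥0 → Lp ℝ q ζ →ₗ[ℝ] (Ω →ₘ[P] ℝ)}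

theorem aemeasurable_apply (t : ℝ≥0) (f : Lp ℝ q ζ) : AEMeasurable (fun ω => L t f ω) P :=
  (L t f).aestronglyMeasurable.aemeasurable

variable [Fact (1 ≤ q)]

theorem IsCylindricalLevyProcess.integral_exp_add (hL : IsCylindricalLevyProcess P ζ q L)
    (f : Lp ℝ q ζ) (s t : ℝ≥0) :
    ∫ ω, Complex.exp (Complex.I * ((L (s + t) f ω : ℝ) : ℂ)) ∂P =
      (∫ ω, Complex.exp (Complex.I * ((L s f ω : ℝ) : ℂ)) ∂P) *
        ∫ ω, Complex.exp (Complex.I * ((L t f ω : ℝ) : ℂ)) ∂P := by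
  have hX := hL.levy 1 (fun _ => f)
  set Y : ℝ≥0 → Ω → (Fin 1 → ℝ) := fun t ω k => L t f ω with hY
  have hind : (Y s) ⟂ᵢ[P] (Y (s + t) - Y s) :=
    hX.indep.indepFun_eval_sub (r := 0) zero_le le_self_add hX.zero
  have hfm : Measurable fun y : Fin 1 → ℝ => Complex.exp (Complex.I * ((y 0 : ℝ) : ℂ)) := by
    fun_prop
  have h1 := hind.integral_fun_comp_mul_comp (hX.aemeasurable s)
    ((hX.aemeasurable (s + t)).sub (hX.aemeasurable s)) hfm.aestronglyMeasurable
    hfm.aestronglyMeasurable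
  have h2 : IdentDistrib (fun ω => Y (s + t) ω - Y s ω) (fun ω => Y t ω) P P := by
    refine (hX.stationary s t).trans (IdentDistrib.of_ae_eq ?_ ?_)
    · exact (hX.aemeasurable t).sub (hX.aemeasurable 0)
    · filter_upwards [hX.zero] with ω hω
      rw [show (Y 0 ω) = 0 from hω]
      exact sub_zero _
  have h3 := (h2.comp hfm).integral_eq
  simp only [Function.comp_def] at h3
  have h4 : ∫ ω, Complex.exp (Complex.I * (((Y (s + t) - Y s) ω 0 : ℝ) : ℂ)) ∂P
      = ∫ ω, Complex.exp (Complex.I * ((Y t ω 0 : ℝ) : ℂ)) ∂P := h3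
  rw [h4] at h1
  rw [← show _ = _ from h1]
  refine integral_congr_ae (Eventually.of_forall fun ω => ?_)
  simp only [hY, Pi.sub_apply]
  rw [← Complex.exp_add]
  congr 1
  push_cast
  ring

variable [IsProbabilityMeasure P]

theorem IsCylindricalLevyProcess.continuous_integral_exp (hL : IsCylindricalLevyProcess P ζ q L)
    (f : Lp ℝ q ζ) :
    Continuous fun t => ∫ ω, Complex.exp (Complex.I * ((L t f ω : ℝ) : ℂ)) ∂P := by
  rw [continuous_iff_continuousAt]
  intro t
  refine tendsto_integral_exp_of_tendstoInMeasure (Y := fun s ω => L s f ω) ?_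
    (fun s => aemeasurable_apply s f) (aemeasurable_apply t f)
  have h := (hL.levy 1 (fun _ => f)).stochContinuous t
  intro ε hε
  refine (h ε hε).congr fun s => ?_
  congr 1
  ext ω
  simp [edist_pi_def]

theorem IsCylindricalLevyProcess.exists_isSymbol (hL : IsCylindricalLevyProcess P ζ q L) :
    ∃ Ψ, IsSymbol P ζ q L Ψ := by
  have h : ∀ f, ∃ z : ℂ, ∀ t : ℝ≥0, ∫ ω, Complex.exp (Complex.I * ((L t f ω : ℝ) : ℂ)) ∂P
      = Complex.exp (((t : ℝ) : ℂ) * z) := by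
    intro f
    refine exists_eq_exp_of_continuous_semigroup (hL.continuous_integral_exp f) ?_
      (hL.integral_exp_add f)
    have h0 := (hL.levy 1 (fun _ => f)).zero
    rw [integral_congr_ae (g := fun _ => (1 : ℂ))]
    · simp
    · filter_upwards [h0] with ω hω
      have : L 0 f ω = 0 := congrFun hω 0
      simp [this]
  choose Ψ hΨ using h
  exact ⟨Ψ, fun t f => hΨ f t⟩

variable {Ψ : Lp ℝ q ζ → ℂ}

theorem IsSymbol.re_nonpos (hΨ : IsSymbol P ζ q L Ψ) (f : Lp ℝ q ζ) : (Ψ f).re ≤ 0 := by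
  have h := hΨ 1 f
  have h1 : ‖∫ ω, Complex.exp (Complex.I * ((L 1 f ω : ℝ) : ℂ)) ∂P‖ ≤ 1 := by
    refine (norm_integral_le_of_norm_le_const (C := 1) (Eventually.of_forall fun ω => ?_)).trans
      (by simp)
    rw [mul_comm, Complex.norm_exp_ofReal_mul_I]
  rw [h, Complex.norm_exp] at h1
  simpa using h1

theorem IsSymbol.apply_zero (hΨ : IsSymbol P ζ q L Ψ) : Ψ 0 = 0 := by
  refine eq_of_forall_exp_mul_eq fun t => ?_
  rw [← hΨ t 0, map_zero, mul_zero, Complex.exp_zero]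
  rw [integral_congr_ae (g := fun _ => (1 : ℂ))]
  · simp
  · filter_upwards [AEEqFun.coeFn_zero (α := Ω) (β := ℝ) (μ := P)] with ω hω
    simp [hω]

theorem IsSymbol.integral_exp_Ioi (hΨ : IsSymbol P ζ q L Ψ) (f : Lp ℝ q ζ) :
    ∫ t in Set.Ioi (0 : ℝ), Complex.exp ((Ψ f - 1) * t) = (1 - Ψ f)⁻¹ := by
  have h := hΨ.re_nonpos f
  rw [integral_exp_mul_complex_Ioi (by simp; linarith)]
  rw [← neg_sub (1 : ℂ), div_neg]
  simp [neg_div]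

theorem IsCylindricalLevyProcess.continuous_symbol (hL : IsCylindricalLevyProcess P ζ q L)
    (hΨ : IsSymbol P ζ q L Ψ) : Continuous Ψ := by
  have hne : ∀ f, (1 : ℂ) - Ψ f ≠ 0 := fun f h => by
    have h1 := hΨ.re_nonpos f
    have h2 := congrArg Complex.re h
    simp at h2
    linarith
  have h1 : Continuous fun f => (1 - Ψ f)⁻¹ := by
    rw [continuous_iff_continuousAt]
    intro f
    simp only [ContinuousAt, ← hΨ.integral_exp_Ioi]
    refine tendsto_integral_filter_of_dominated_convergence (fun t => Real.exp (-1 * t)) ?_ ?_ ?_ ?_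
    · exact Eventually.of_forall fun g => by fun_prop
    · refine Eventually.of_forall fun g => ?_
      filter_upwards [ae_restrict_mem measurableSet_Ioi] with t ht
      rw [Complex.norm_exp]
      have h1 := hΨ.re_nonpos g
      have ht' : 0 < t := ht
      simp only [Complex.mul_re, Complex.sub_re, Complex.one_re, Complex.ofReal_re,
        Complex.ofReal_im, mul_zero, sub_zero]
      gcongr
      linarith
    · exact integrableOn_exp_mul_Ioi (by norm_num) 0
    · filter_upwards [ae_restrict_mem measurableSet_Ioi] with t ht
      have ht' : 0 < t := ht
      have h2 := tendsto_integral_exp_of_tendstoInMeasure (hL.continuous t.toNNReal f)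
        (fun g => aemeasurable_apply _ g) (aemeasurable_apply _ f)
      have h3 : ∀ g, Complex.exp ((Ψ g - 1) * t) = Complex.exp (-t) *
          ∫ ω, Complex.exp (Complex.I * ((L t.toNNReal g ω : ℝ) : ℂ)) ∂P := by
        intro g
        rw [hΨ, ← Complex.exp_add]
        congr 1
        rw [Real.coe_toNNReal t ht'.le]
        ring
      simp only [h3]
      exact h2.const_mul _
  have h2 : Continuous fun f => 1 - ((1 - Ψ f)⁻¹)⁻¹ :=
    continuous_const.sub (h1.inv₀ fun f => inv_ne_zero (hne f))
  simpa using h2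

end Symbol

end CylLevy

namespace CylLevy

/-! ### The Lévy–Khintchine formula on the real line -/

section LevyKhintchine

theorem norm_exp_I_mul_sub_one_sub_le (x : ℝ) :
    ‖Complex.exp (Complex.I * (x : ℂ)) - 1 - Complex.I * (x : ℂ)‖ ≤ 3 * x ^ 2 := by
  have hn : ‖Complex.I * (x : ℂ)‖ = |x| := by simp
  rcases le_total |x| 1 with h | h
  · refine (Complex.norm_exp_sub_one_sub_id_le (by rwa [hn])).trans ?_
    rw [hn, sq_abs]
    nlinarith [sq_nonneg x]
  · have h1 : ‖Complex.exp (Complex.I * (x : ℂ))‖ = 1 := by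
      rw [mul_comm, Complex.norm_exp_ofReal_mul_I]
    have h2 : ‖Complex.exp (Complex.I * (x : ℂ)) - 1 - Complex.I * (x : ℂ)‖ ≤ 1 + 1 + |x| := by
      refine (norm_sub_le _ _).trans (add_le_add ((norm_sub_le _ _).trans ?_) hn.le)
      rw [h1]; simp
    nlinarith [sq_abs x]

theorem norm_exp_I_mul_sub_one_le (x : ℝ) : ‖Complex.exp (Complex.I * (x : ℂ)) - 1‖ ≤ 2 := by
  have h1 : ‖Complex.exp (Complex.I * (x : ℂ))‖ = 1 := by
    rw [mul_comm, Complex.norm_exp_ofReal_mul_I]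
  refine (norm_sub_le _ _).trans ?_
  rw [h1]
  norm_num

theorem abs_self_sub_sin_le (y : ℝ) : |y - Real.sin y| ≤ 3 * y ^ 2 := by
  have h := (Complex.abs_im_le_norm _).trans (norm_exp_I_mul_sub_one_sub_le y)
  rw [mul_comm, Complex.exp_mul_I, ← Complex.ofReal_cos, ← Complex.ofReal_sin] at h
  simp only [Complex.sub_im, Complex.add_im, Complex.ofReal_im, Complex.mul_im, Complex.ofReal_re,
    Complex.I_im, Complex.I_re, Complex.one_im, mul_one, mul_zero, zero_add, sub_zero,
    add_zero] at h
  rwa [abs_sub_comm]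

/-- The weight `1 - sin y / y`, comparable to `1 ∧ y²`. -/
noncomputable def weight (y : ℝ) : ℝ := 1 - Real.sinc y

@[simp] theorem weight_zero : weight 0 = 0 := by simp [weight]

theorem weight_nonneg (y : ℝ) : 0 ≤ weight y := sub_nonneg.2 (Real.sinc_le_one y)

theorem weight_le_two (y : ℝ) : weight y ≤ 2 := by
  have := Real.neg_one_le_sinc y
  unfold weight
  linarith

theorem continuous_weight : Continuous weight := continuous_const.sub Real.continuous_sinc

theorem sin_le_of_nonneg_of_le_one {y : ℝ} (h0 : 0 ≤ y) (h1 : y ≤ 1) :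
    Real.sin y ≤ y - 11 / 96 * y ^ 3 := by
  have h := (abs_le.1 (Real.sin_bound (x := y) (by rwa [abs_of_nonneg h0]))).2
  rw [abs_of_nonneg h0] at h
  have : y ^ 5 ≤ y ^ 3 := pow_le_pow_of_le_one h0 h1 (by norm_num)
  have : 0 ≤ y ^ 3 := pow_nonneg h0 3
  linarith

theorem le_weight (y : ℝ) : 11 / 384 * min 1 (y ^ 2) ≤ weight y := by
  wlog hy : 0 ≤ y generalizing y
  · have := this (-y) (by linarith)
    simpa [weight] using this
  rcases hy.eq_or_lt with rfl | hy
  · simp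
  have hw : weight y = 1 - Real.sin y / y := by rw [weight, Real.sinc_of_ne_zero hy.ne']
  rw [hw]
  rcases le_total y 1 with h1 | h1
  · have h := sin_le_of_nonneg_of_le_one hy.le h1
    have h2 : Real.sin y / y ≤ 1 - 11 / 96 * y ^ 2 := by
      rw [div_le_iff₀ hy]
      nlinarith
    have h3 : min 1 (y ^ 2) ≤ y ^ 2 := min_le_right _ _
    nlinarith [sq_nonneg y]
  · have h3 : min 1 (y ^ 2) ≤ 1 := min_le_left _ _
    suffices h2 : Real.sin y / y ≤ 1 - 11 / 384 by linarith
    rw [div_le_iff₀ hy]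
    rcases le_total y 2 with h2 | h2
    · have h := sin_le_of_nonneg_of_le_one (y := y / 2) (by linarith) (by linarith)
      have h4 : Real.sin y = 2 * Real.sin (y / 2) * Real.cos (y / 2) := by
        rw [← Real.sin_two_mul]; congr 1; ring
      have h5 : 0 ≤ Real.sin (y / 2) := Real.sin_nonneg_of_nonneg_of_le_pi (by linarith)
        (by linarith [Real.pi_gt_three])
      have h6 : Real.sin y ≤ 2 * Real.sin (y / 2) := by
        rw [h4]
        nlinarith [Real.cos_le_one (y / 2)]
      have h7 : y ≤ y ^ 3 := by nlinarith
      nlinarith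
    · linarith [Real.sin_le_one y]

theorem weight_pos {y : ℝ} (hy : y ≠ 0) : 0 < weight y :=
  lt_of_lt_of_le (by positivity) (le_weight y)

/-- The integrand `e^{iuy} - 1 - iu sin y`. -/
noncomputable def sinIntegrand (u y : ℝ) : ℂ :=
  Complex.exp (Complex.I * ((u * y : ℝ) : ℂ)) - 1 - Complex.I * ((u * Real.sin y : ℝ) : ℂ)

@[simp] theorem sinIntegrand_zero_right (u : ℝ) : sinIntegrand u 0 = 0 := by simp [sinIntegrand]

theorem continuous_sinIntegrand (u : ℝ) : Continuous (sinIntegrand u) := by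
  unfold sinIntegrand
  fun_prop

theorem norm_sinIntegrand_le (u y : ℝ) :
    ‖sinIntegrand u y‖ ≤ (3 * u ^ 2 + 3 * |u| + 2) * min 1 (y ^ 2) := by
  have hu := abs_nonneg u
  rcases le_total 1 (y ^ 2) with h | h
  · rw [min_eq_left h, mul_one]
    refine (norm_sub_le _ _).trans ?_
    have h1 := norm_exp_I_mul_sub_one_le (u * y)
    have h2 : ‖Complex.I * ((u * Real.sin y : ℝ) : ℂ)‖ ≤ |u| := by
      rw [norm_mul, Complex.norm_I, one_mul, Complex.norm_real, Real.norm_eq_abs, abs_mul]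
      nlinarith [Real.abs_sin_le_one y]
    nlinarith [sq_nonneg u]
  · rw [min_eq_right h]
    have h0 : sinIntegrand u y = (Complex.exp (Complex.I * ((u * y : ℝ) : ℂ)) - 1
        - Complex.I * ((u * y : ℝ) : ℂ)) + Complex.I * ((u * (y - Real.sin y) : ℝ) : ℂ) := by
      rw [sinIntegrand]; push_cast; ring
    rw [h0]
    refine (norm_add_le _ _).trans ?_
    have h1 := norm_exp_I_mul_sub_one_sub_le (u * y)
    have h2 : ‖Complex.I * ((u * (y - Real.sin y) : ℝ) : ℂ)‖ ≤ |u| * (3 * y ^ 2) := by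
      rw [norm_mul, Complex.norm_I, one_mul, Complex.norm_real, Real.norm_eq_abs, abs_mul]
      gcongr
      exact abs_self_sub_sin_le y
    nlinarith [sq_nonneg y]

/-- The Khintchine kernel: the continuous extension of `sinIntegrand u y / weight y`. -/
noncomputable def kernel (u y : ℝ) : ℂ :=
  if y = 0 then -3 * (u : ℂ) ^ 2 else sinIntegrand u y / (weight y : ℂ)

theorem tendsto_weight_div_sq :
    Tendsto (fun y : ℝ => weight y / y ^ 2) (𝓝[≠] 0) (𝓝 (1 / 6)) := by
  rw [tendsto_iff_norm_sub_tendsto_zero]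
  refine squeeze_zero' (Eventually.of_forall fun y => norm_nonneg _) (g := fun y => |y|) ?_ ?_
  · have h1 : ∀ᶠ y : ℝ in 𝓝[≠] 0, |y| ≤ 1 := by
      refine nhdsWithin_le_nhds ?_
      filter_upwards [Metric.closedBall_mem_nhds (0 : ℝ) one_pos] with y hy
      simpa using hy
    filter_upwards [h1, self_mem_nhdsWithin] with y hy hy0
    have hy0' : y ≠ 0 := hy0
    have h := Real.sin_bound hy
    have h2 : weight y / y ^ 2 - 1 / 6 = -(Real.sin y - (y - y ^ 3 / 6)) / y ^ 3 := by
      rw [weight, Real.sinc_of_ne_zero hy0']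
      field_simp
      ring
    rw [h2, Real.norm_eq_abs, abs_div, abs_neg, abs_pow, div_le_iff₀ (by positivity)]
    refine h.trans ?_
    nlinarith [pow_nonneg (abs_nonneg y) 4]
  · simpa using (continuous_abs.tendsto (0 : ℝ)).mono_left nhdsWithin_le_nhds

theorem tendsto_sinIntegrand_div_sq (u : ℝ) :
    Tendsto (fun y : ℝ => sinIntegrand u y / (y : ℂ) ^ 2) (𝓝[≠] 0) (𝓝 (-(u : ℂ) ^ 2 / 2)) := by
  rw [tendsto_iff_norm_sub_tendsto_zero]
  set C : ℝ := |u| ^ 3 * Real.exp |u| + |u| with hC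
  refine squeeze_zero' (Eventually.of_forall fun y => norm_nonneg _) (g := fun y => C * |y|) ?_ ?_
  · have h1 : ∀ᶠ y : ℝ in 𝓝[≠] 0, |y| ≤ 1 := by
      refine nhdsWithin_le_nhds ?_
      filter_upwards [Metric.closedBall_mem_nhds (0 : ℝ) one_pos] with y hy
      simpa using hy
    filter_upwards [h1, self_mem_nhdsWithin] with y hy hy0
    have hy0' : y ≠ 0 := hy0
    have hyC : (y : ℂ) ≠ 0 := by exact_mod_cast hy0'
    set z : ℂ := Complex.I * ((u * y : ℝ) : ℂ) with hz
    have hzn : ‖z‖ = |u| * |y| := by simp [hz]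
    have hA := Complex.norm_exp_sub_sum_le_norm_mul_exp z 3
    have h2 : sinIntegrand u y / (y : ℂ) ^ 2 - -(u : ℂ) ^ 2 / 2 =
        ((Complex.exp z - ∑ m ∈ Finset.range 3, z ^ m / (m.factorial : ℂ))
          + Complex.I * ((u * (y - Real.sin y) : ℝ) : ℂ)) / (y : ℂ) ^ 2 := by
      have hz2 : z ^ 2 = -((u : ℂ) ^ 2 * (y : ℂ) ^ 2) := by
        rw [hz, mul_pow, Complex.I_sq]; push_cast; ring
      simp only [Finset.sum_range_succ, Finset.sum_range_zero, Nat.factorial, sinIntegrand, hz2,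
        ← hz]
      field_simp
      rw [hz]
      push_cast
      ring
    have hB : ‖Complex.I * ((u * (y - Real.sin y) : ℝ) : ℂ)‖ ≤ |u| * |y| ^ 3 := by
      rw [norm_mul, Complex.norm_I, one_mul, Complex.norm_real, Real.norm_eq_abs, abs_mul]
      gcongr
      have h := Real.sin_bound hy
      have h3 : |y - Real.sin y| ≤ |Real.sin y - (y - y ^ 3 / 6)| + |y ^ 3 / 6| := by
        rw [abs_sub_comm (Real.sin y)]
        have := abs_add_le (y - y ^ 3 / 6 - Real.sin y) (y ^ 3 / 6)
        rwa [show y - y ^ 3 / 6 - Real.sin y + y ^ 3 / 6 = y - Real.sin y by ring] at this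
      have h4 : |y ^ 3 / 6| = |y| ^ 3 / 6 := by rw [abs_div, abs_pow]; norm_num
      have h5 : |y| ^ 5 ≤ |y| ^ 3 := pow_le_pow_of_le_one (abs_nonneg y) hy (by norm_num)
      have h6 : 0 ≤ |y| ^ 3 := by positivity
      linarith
    have hA' : ‖z‖ ^ 3 * Real.exp ‖z‖ ≤ |u| ^ 3 * Real.exp |u| * |y| ^ 3 := by
      rw [hzn, mul_pow]
      have : Real.exp (|u| * |y|) ≤ Real.exp |u| :=
        Real.exp_le_exp.2 (mul_le_of_le_one_right (abs_nonneg u) hy)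
      calc |u| ^ 3 * |y| ^ 3 * Real.exp (|u| * |y|) ≤ |u| ^ 3 * |y| ^ 3 * Real.exp |u| := by gcongr
        _ = _ := by ring
    rw [h2, norm_div, norm_pow, Complex.norm_real, Real.norm_eq_abs, div_le_iff₀ (by positivity)]
    refine (norm_add_le _ _).trans ?_
    calc _ ≤ |u| ^ 3 * Real.exp |u| * |y| ^ 3 + |u| * |y| ^ 3 := add_le_add (hA.trans hA') hB
      _ = C * |y| * |y| ^ 2 := by rw [hC]; ring
  · simpa using ((continuous_abs.tendsto (0 : ℝ)).mono_left nhdsWithin_le_nhds).const_mul C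

theorem continuous_kernel (u : ℝ) : Continuous (kernel u) := by
  rw [continuous_iff_continuousAt]
  intro y
  by_cases hy : y = 0
  · subst hy
    rw [← continuousWithinAt_compl_self]
    have hw : Tendsto (fun y : ℝ => ((weight y / y ^ 2 : ℝ) : ℂ)) (𝓝[≠] 0)
        (𝓝 (((1 / 6 : ℝ)) : ℂ)) :=
      (Complex.continuous_ofReal.tendsto _).comp tendsto_weight_div_sq
    have h := (tendsto_sinIntegrand_div_sq u).div hw (by norm_num)
    have h0 : kernel u 0 = -(u : ℂ) ^ 2 / 2 / ((1 / 6 : ℝ) : ℂ) := by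
      simp only [kernel, if_true]
      push_cast
      ring
    rw [ContinuousWithinAt, h0]
    refine h.congr' ?_
    filter_upwards [self_mem_nhdsWithin] with y hy
    have hy' : (y : ℂ) ≠ 0 := by exact_mod_cast hy
    rw [kernel, if_neg (show y ≠ 0 from hy)]
    simp only [Pi.div_apply]
    push_cast
    exact div_div_div_cancel_right₀ (pow_ne_zero 2 hy') _ _
  · have h1 : ContinuousAt (fun y => sinIntegrand u y / (weight y : ℂ)) y := by
      refine ContinuousAt.div (continuous_sinIntegrand u).continuousAt
        (Complex.continuous_ofReal.comp continuous_weight).continuousAt ?_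
      exact_mod_cast (weight_pos hy).ne'
    refine h1.congr ?_
    filter_upwards [isOpen_ne.mem_nhds hy] with z hz
    rw [kernel, if_neg hz]

theorem norm_kernel_le (u y : ℝ) :
    ‖kernel u y‖ ≤ 3 * u ^ 2 + (3 * u ^ 2 + 3 * |u| + 2) * (384 / 11) := by
  have hu := abs_nonneg u
  by_cases hy : y = 0
  · simp only [kernel, hy, if_true, norm_mul, norm_neg, norm_pow, Complex.norm_real,
      Real.norm_eq_abs, sq_abs]
    norm_num
    positivity
  · rw [kernel, if_neg hy, norm_div, Complex.norm_real, Real.norm_eq_abs,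
      abs_of_pos (weight_pos hy)]
    have h1 : ‖sinIntegrand u y‖ / weight y ≤ (3 * u ^ 2 + 3 * |u| + 2) * (384 / 11) := by
      rw [div_le_iff₀ (weight_pos hy)]
      refine (norm_sinIntegrand_le u y).trans ?_
      rw [mul_assoc]
      gcongr
      linarith [le_weight y]
    linarith [sq_nonneg u]

theorem kernel_mul_weight (u y : ℝ) : (weight y : ℂ) * kernel u y = sinIntegrand u y := by
  by_cases hy : y = 0
  · simp [hy]
  · rw [kernel, if_neg hy, mul_div_cancel₀]
    exact_mod_cast (weight_pos hy).ne'

end LevyKhintchine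

end CylLevy

namespace CylLevy

section LevyKhintchineLimit

theorem charFun_real_eq (μ : Measure ℝ) (u : ℝ) :
    charFun μ u = ∫ y, Complex.exp (Complex.I * ((u * y : ℝ) : ℂ)) ∂μ := by
  rw [charFun_apply]
  refine integral_congr_ae (Eventually.of_forall fun y => ?_)
  simp only [RCLike.inner_apply, conj_trivial]
  rw [mul_comm Complex.I]

/-- Finite measures on the line whose characteristic functions converge pointwise to a function
that is continuous at `0` have a weak limit along some filter. -/
theorem exists_tendsto_finiteMeasure_of_tendsto_charFun {M : ℕ → FiniteMeasure ℝ} {χ : ℝ → ℂ}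
    (hχ : ContinuousAt χ 0)
    (h : ∀ u, Tendsto (fun n => charFun (M n : Measure ℝ) u) atTop (𝓝 (χ u))) :
    ∃ (U : Filter ℕ) (M₀ : FiniteMeasure ℝ), U.NeBot ∧ U ≤ atTop ∧ Tendsto M U (𝓝 M₀) := by
  have hmassC : Tendsto (fun n => (((M n).mass : ℝ) : ℂ)) atTop (𝓝 (χ 0)) := by
    refine (h 0).congr fun n => ?_
    rw [charFun_zero]
    rfl
  have hmass : Tendsto (fun n => ((M n).mass : ℝ)) atTop (𝓝 (χ 0).re) := by
    exact ((Complex.continuous_re.tendsto _).comp hmassC).congr fun n => Complex.ofReal_re _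
  have hχ0 : χ 0 = ((χ 0).re : ℂ) := by
    have := (Complex.continuous_ofReal.tendsto _).comp hmass
    exact tendsto_nhds_unique hmassC this
  rcases eq_or_ne (χ 0).re 0 with h0 | h0
  · refine ⟨atTop, 0, inferInstance, le_rfl, ?_⟩
    refine FiniteMeasure.tendsto_zero_of_tendsto_zero_mass ?_
    rw [h0] at hmass
    rw [← NNReal.tendsto_coe]
    exact hmass
  have hne : ∀ᶠ n in atTop, M n ≠ 0 := by
    filter_upwards [hmass.eventually_ne h0] with n hn hM
    exact hn (by simp [hM])
  set N : ℕ → ProbabilityMeasure ℝ := fun n => (M n).normalize with hN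
  have hcf : ∀ u, Tendsto (fun n => charFun (N n : Measure ℝ) u) atTop (𝓝 (χ u / χ 0)) := by
    intro u
    refine ((h u).div hmassC (by rw [hχ0]; exact_mod_cast h0)).congr' ?_
    filter_upwards [hne] with n hn
    have h1 : (M n).mass ≠ 0 := fun h => hn ((FiniteMeasure.mass_zero_iff _).1 h)
    have h2 : (N n : Measure ℝ) = (M n).mass⁻¹ • (M n : Measure ℝ) :=
      (M n).toMeasure_normalize_eq_of_nonzero hn
    simp only [Pi.div_apply]
    rw [h2, charFun_apply, charFun_apply, integral_smul_nnreal_measure, NNReal.smul_def,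
      div_eq_inv_mul]
    simp
  have htight := isTightMeasureSet_of_tendsto_charFun (μ := fun n => (N n : Measure ℝ))
    (f := fun u => χ u / χ 0) (hχ.div_const _) hcf
  have hcomp : IsCompact (closure (Set.range N)) := by
    refine isCompact_closure_of_isTightMeasureSet (htight.subset ?_)
    rintro _ ⟨μ, ⟨n, rfl⟩, rfl⟩
    exact ⟨n, rfl⟩
  obtain ⟨π, -, hπ⟩ := hcomp.ultrafilter_le_nhds ((Ultrafilter.of (atTop : Filter ℕ)).map N)
    (by
      rw [Ultrafilter.coe_map, le_principal_iff]
      exact mem_map.2 (Eventually.of_forall fun n => subset_closure ⟨n, rfl⟩))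
  have hU : (Ultrafilter.of (atTop : Filter ℕ) : Filter ℕ) ≤ atTop := Ultrafilter.of_le _
  have hπ' : Tendsto N (Ultrafilter.of (atTop : Filter ℕ)) (𝓝 π) := hπ
  refine ⟨Ultrafilter.of (atTop : Filter ℕ), (χ 0).re.toNNReal • π.toFiniteMeasure, inferInstance,
    hU, ?_⟩
  rw [FiniteMeasure.tendsto_iff_forall_integral_tendsto]
  intro f
  rw [ProbabilityMeasure.tendsto_iff_forall_integral_tendsto] at hπ'
  have h1 := (hmass.mono_left hU).mul (hπ' f)
  have hpos : 0 ≤ (χ 0).re := ge_of_tendsto' hmass fun n => NNReal.coe_nonneg _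
  have h2 : ∫ x, f x ∂(((χ 0).re.toNNReal • π.toFiniteMeasure : FiniteMeasure ℝ) : Measure ℝ)
      = (χ 0).re * ∫ x, f x ∂(π : Measure ℝ) := by
    rw [FiniteMeasure.toMeasure_smul, integral_smul_nnreal_measure, NNReal.smul_def,
      Real.coe_toNNReal _ hpos]
    rfl
  rw [h2]
  refine h1.congr fun n => ?_
  conv_rhs => rw [(M n).self_eq_mass_smul_normalize]
  rw [FiniteMeasure.toMeasure_smul, integral_smul_nnreal_measure, NNReal.smul_def]
  rfl

theorem norm_mul_exp_div_sub_one_le (z : ℂ) (n : ℕ) :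
    ‖((n : ℂ) + 1) * (Complex.exp (z / ((n : ℂ) + 1)) - 1)‖ ≤ ‖z‖ * Real.exp ‖z‖ := by
  have hn : ‖(n : ℂ) + 1‖ = (n : ℝ) + 1 := by
    rw [← Nat.cast_add_one, Complex.norm_natCast, Nat.cast_add_one]
  have h := Complex.norm_exp_sub_sum_le_norm_mul_exp (z / ((n : ℂ) + 1)) 1
  simp only [Finset.range_one, Finset.sum_singleton, pow_zero, Nat.factorial, Nat.cast_one, div_one,
    pow_one, norm_div, hn] at h
  have hp : (0 : ℝ) < (n : ℝ) + 1 := by positivity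
  rw [norm_mul, hn]
  calc ((n : ℝ) + 1) * ‖Complex.exp (z / ((n : ℂ) + 1)) - 1‖
      ≤ ((n : ℝ) + 1) * (‖z‖ / ((n : ℝ) + 1) * Real.exp (‖z‖ / ((n : ℝ) + 1))) := by gcongr
    _ = ‖z‖ * Real.exp (‖z‖ / ((n : ℝ) + 1)) := by field_simp
    _ ≤ ‖z‖ * Real.exp ‖z‖ := by
        gcongr
        exact div_le_self (norm_nonneg _) (by linarith [Nat.cast_nonneg (α := ℝ) n])

theorem tendsto_mul_exp_div_sub_one (z : ℂ) :
    Tendsto (fun n : ℕ => ((n : ℂ) + 1) * (Complex.exp (z / ((n : ℂ) + 1)) - 1)) atTop (𝓝 z) := by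
  have hd : HasDerivAt (fun s : ℝ => Complex.exp ((s : ℂ) * z)) z 0 := by
    have : HasDerivAt (fun s : ℝ => (s : ℂ)) 1 0 := Complex.ofRealCLM.hasDerivAt
    simpa using (this.mul_const z).cexp
  have h1 : Tendsto (fun n : ℕ => ((n : ℝ) + 1)⁻¹) atTop (𝓝[≠] 0) := by
    refine tendsto_nhdsWithin_iff.2 ⟨?_, Eventually.of_forall fun n => ?_⟩
    · simpa using tendsto_one_div_add_atTop_nhds_zero_nat (𝕜 := ℝ)
    · have : (0 : ℝ) < (n : ℝ) + 1 := by positivity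
      exact (inv_pos.2 this).ne'
  have h2 := hd.tendsto_slope_zero.comp h1
  refine h2.congr fun n => ?_
  simp only [Function.comp, inv_inv, zero_add, Complex.ofReal_zero, zero_mul, Complex.exp_zero,
    Complex.real_smul]
  push_cast
  rw [div_eq_inv_mul]

theorem integral_exp_shift (u y : ℝ) :
    ∫ s in (-1 : ℝ)..1, Complex.exp (Complex.I * (((u + s) * y : ℝ) : ℂ)) =
      2 * ((Real.sinc y : ℝ) : ℂ) * Complex.exp (Complex.I * ((u * y : ℝ) : ℂ)) := by
  have h0 : ∀ s : ℝ, Complex.exp (Complex.I * (((u + s) * y : ℝ) : ℂ)) =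
      Complex.exp (Complex.I * ((u * y : ℝ) : ℂ)) * Complex.exp ((Complex.I * y) * s) := by
    intro s
    rw [← Complex.exp_add]
    congr 1
    push_cast
    ring
  simp only [h0]
  rw [intervalIntegral.integral_const_mul, mul_comm]
  congr 1
  by_cases hy : y = 0
  · subst hy
    simp
    norm_num
  · have hyC : (y : ℂ) ≠ 0 := by exact_mod_cast hy
    rw [integral_exp_mul_complex (mul_ne_zero Complex.I_ne_zero hyC), Real.sinc_of_ne_zero hy]
    push_cast
    have e1 : Complex.I * (y : ℂ) * 1 = y * Complex.I := by ring
    have e2 : Complex.I * (y : ℂ) * -1 = ((-y : ℝ) : ℂ) * Complex.I := by push_cast; ring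
    rw [e1, e2, Complex.exp_mul_I, Complex.exp_mul_I, ← Complex.ofReal_cos, ← Complex.ofReal_sin,
      ← Complex.ofReal_cos, ← Complex.ofReal_sin, Real.cos_neg, Real.sin_neg]
    push_cast
    field_simp
    ring

theorem integral_weight_mul_exp (μ : Measure ℝ) [IsProbabilityMeasure μ] (u : ℝ) :
    ∫ y, (weight y : ℂ) * Complex.exp (Complex.I * ((u * y : ℝ) : ℂ)) ∂μ =
      charFun μ u - 1 / 2 * ∫ s in (-1 : ℝ)..1, charFun μ (u + s) := by
  have hb : ∀ (v : ℝ) (g : ℝ → ℂ), Continuous g → (∀ y, ‖g y‖ ≤ 2) →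
      Integrable (fun y => g y * Complex.exp (Complex.I * ((v * y : ℝ) : ℂ))) μ := by
    intro v g hg hgb
    refine Integrable.of_bound (C := 2) (by fun_prop) (Eventually.of_forall fun y => ?_)
    rw [norm_mul, mul_comm Complex.I, Complex.norm_exp_ofReal_mul_I, mul_one]
    exact hgb y
  have hswap : ∫ s in (-1 : ℝ)..1, charFun μ (u + s) =
      ∫ y, 2 * ((Real.sinc y : ℝ) : ℂ) * Complex.exp (Complex.I * ((u * y : ℝ) : ℂ)) ∂μ := by
    simp only [charFun_real_eq]
    rw [intervalIntegral.integral_of_le (by norm_num), integral_integral_swap]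
    · refine integral_congr_ae (Eventually.of_forall fun y => ?_)
      simp only
      rw [← integral_exp_shift, intervalIntegral.integral_of_le (by norm_num)]
    · refine Integrable.of_bound (C := 1) ?_ (Eventually.of_forall fun z => ?_)
      · exact Continuous.aestronglyMeasurable (by unfold Function.uncurry; fun_prop)
      · simp only [Function.uncurry]
        rw [mul_comm Complex.I, Complex.norm_exp_ofReal_mul_I]
  have hsc : Integrable (fun y => ((Real.sinc y : ℝ) : ℂ) *
      Complex.exp (Complex.I * ((u * y : ℝ) : ℂ))) μ := by
    refine hb u (fun y => ((Real.sinc y : ℝ) : ℂ))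
      (Complex.continuous_ofReal.comp Real.continuous_sinc) fun y => ?_
    rw [Complex.norm_real, Real.norm_eq_abs]
    exact (Real.abs_sinc_le_one y).trans (by norm_num)
  have h1 : Integrable (fun y => Complex.exp (Complex.I * ((u * y : ℝ) : ℂ))) μ := by
    simpa using hb u (fun _ => 1) continuous_const (by simp)
  rw [hswap, charFun_real_eq, ← integral_const_mul, ← integral_sub h1 (by
    have := hsc.const_mul 1
    refine this.congr (Eventually.of_forall fun y => ?_)
    simp only
    ring)]
  refine integral_congr_ae (Eventually.of_forall fun y => ?_)
  simp only [weight]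
  push_cast
  ring

theorem exists_levyKhintchine {ψ : ℝ → ℂ} (hψ : Continuous ψ) (μ : ℕ → Measure ℝ)
    [∀ n, IsProbabilityMeasure (μ n)]
    (hμ : ∀ n u, charFun (μ n) u = Complex.exp (ψ u / ((n : ℂ) + 1))) :
    ∃ (M : Measure ℝ) (γ : ℝ), IsFiniteMeasure M ∧
      (∀ u, charFun M u = ψ u - 1 / 2 * ∫ s in (-1 : ℝ)..1, ψ (u + s)) ∧
      ∀ u, ψ u = Complex.I * ((u * γ : ℝ) : ℂ) + ∫ y, kernel u y ∂M := by
  have hfin : ∀ n, IsFiniteMeasure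
      ((μ n).withDensity fun y => ENNReal.ofReal (((n : ℝ) + 1) * weight y)) := by
    intro n
    refine isFiniteMeasure_withDensity_ofReal ?_
    refine (Integrable.of_bound (C := ((n : ℝ) + 1) * 2) ?_ (Eventually.of_forall fun y => ?_)).2
    · exact (continuous_const.mul continuous_weight).aestronglyMeasurable
    · rw [Real.norm_eq_abs, abs_of_nonneg (mul_nonneg (by positivity) (weight_nonneg y))]
      gcongr
      exact weight_le_two y
  set M : ℕ → FiniteMeasure ℝ := fun n => ⟨_, hfin n⟩ with hM
  have hMint : ∀ n (g : ℝ → ℂ), ∫ y, g y ∂(M n : Measure ℝ) =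
      ((n : ℂ) + 1) * ∫ y, (weight y : ℂ) * g y ∂(μ n) := by
    intro n g
    have : (M n : Measure ℝ)
        = (μ n).withDensity fun y => ENNReal.ofReal (((n : ℝ) + 1) * weight y) := rfl
    rw [this, integral_withDensity_eq_integral_toReal_smul
      (by have := continuous_weight.measurable; fun_prop)
      (Eventually.of_forall fun _ => ENNReal.ofReal_lt_top), ← integral_const_mul]
    refine integral_congr_ae (Eventually.of_forall fun y => ?_)
    simp only
    rw [ENNReal.toReal_ofReal (mul_nonneg (by positivity) (weight_nonneg y)), Complex.real_smul]
    push_cast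
    ring
  set χ : ℝ → ℂ := fun u => ψ u - 1 / 2 * ∫ s in (-1 : ℝ)..1, ψ (u + s) with hχ
  have hχc : Continuous χ := by
    refine hψ.sub (continuous_const.mul ?_)
    exact intervalIntegral.continuous_parametric_intervalIntegral_of_continuous' (by fun_prop) _ _
  have hlim : ∀ u, Tendsto (fun n : ℕ => ((n : ℂ) + 1) * (charFun (μ n) u - 1)) atTop
      (𝓝 (ψ u)) := by
    intro u
    simp only [hμ]
    exact tendsto_mul_exp_div_sub_one (ψ u)
  have hcf : ∀ u, Tendsto (fun n => charFun (M n : Measure ℝ) u) atTop (𝓝 (χ u)) := by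
    intro u
    have h1 : ∀ n, charFun (M n : Measure ℝ) u = ((n : ℂ) + 1) * (charFun (μ n) u - 1)
        - 1 / 2 * ∫ s in (-1 : ℝ)..1, ((n : ℂ) + 1) * (charFun (μ n) (u + s) - 1) := by
      intro n
      have hi : IntervalIntegrable (fun s => charFun (μ n) (u + s)) volume (-1) 1 :=
        Continuous.intervalIntegrable (by fun_prop) _ _
      rw [charFun_real_eq, hMint, integral_weight_mul_exp, intervalIntegral.integral_const_mul,
        intervalIntegral.integral_sub hi (by simp)]
      simp
      ring
    simp only [h1]
    refine (hlim u).sub (Tendsto.const_mul _ ?_)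
    obtain ⟨B, hB⟩ := (isCompact_Icc (a := (-1 : ℝ)) (b := 1)).exists_bound_of_continuousOn
      (f := fun s => ψ (u + s)) (by fun_prop)
    refine intervalIntegral.tendsto_integral_filter_of_dominated_convergence
      (fun _ => B * Real.exp B) (Eventually.of_forall fun n => ?_)
      (Eventually.of_forall fun n => ?_) (by simp) ?_
    · exact Continuous.aestronglyMeasurable (by fun_prop)
    · refine Eventually.of_forall fun s hs => ?_
      rw [Set.uIoc_of_le (by norm_num)] at hs
      have hs' := hB s ⟨hs.1.le, hs.2⟩
      rw [hμ]
      refine (norm_mul_exp_div_sub_one_le _ _).trans ?_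
      have : 0 ≤ B := (norm_nonneg _).trans hs'
      gcongr
    · exact Eventually.of_forall fun s _ => hlim (u + s)
  obtain ⟨U, M₀, hU, hUle, hMlim⟩ :=
    exists_tendsto_finiteMeasure_of_tendsto_charFun hχc.continuousAt hcf
  rw [FiniteMeasure.tendsto_iff_forall_integral_rclike_tendsto ℂ] at hMlim
  have hMχ : ∀ u, charFun (M₀ : Measure ℝ) u = χ u := by
    intro u
    refine tendsto_nhds_unique ?_ ((hcf u).mono_left hUle)
    have := hMlim (BoundedContinuousFunction.innerProbChar u)
    simpa only [charFun_eq_integral_innerProbChar] using this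
  set K : ℝ → BoundedContinuousFunction ℝ ℂ := fun u =>
    BoundedContinuousFunction.ofNormedAddCommGroup (kernel u) (continuous_kernel u) _
      (norm_kernel_le u) with hK
  set b : ℕ → ℝ := fun n => ((n : ℝ) + 1) * ∫ y, Real.sin y ∂(μ n) with hb
  have hdrift : ∀ (u : ℝ) (n : ℕ), ((n : ℂ) + 1) * (charFun (μ n) u - 1) =
      Complex.I * ((u * b n : ℝ) : ℂ) + ∫ y, K u y ∂(M n : Measure ℝ) := by
    intro u n
    have hk : ∀ y, (weight y : ℂ) * K u y = sinIntegrand u y := kernel_mul_weight u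
    have hi1 : Integrable (fun y : ℝ => Complex.exp (Complex.I * ((u * y : ℝ) : ℂ))) (μ n) := by
      refine Integrable.of_bound (C := 1) (by fun_prop) (Eventually.of_forall fun y => ?_)
      rw [mul_comm Complex.I, Complex.norm_exp_ofReal_mul_I]
    have hi2 : Integrable (fun y : ℝ => Complex.I * ((u * Real.sin y : ℝ) : ℂ)) (μ n) := by
      refine Integrable.of_bound (C := |u|) (by fun_prop) (Eventually.of_forall fun y => ?_)
      rw [norm_mul, Complex.norm_I, one_mul, Complex.norm_real, Real.norm_eq_abs, abs_mul]
      exact mul_le_of_le_one_right (abs_nonneg u) (Real.abs_sin_le_one y)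
    have hi3 : ∫ y, Complex.I * ((u * Real.sin y : ℝ) : ℂ) ∂(μ n)
        = Complex.I * ((u * ∫ y, Real.sin y ∂(μ n) : ℝ) : ℂ) := by
      rw [integral_const_mul, integral_complex_ofReal, integral_const_mul]
    rw [hMint]
    simp only [hk, sinIntegrand]
    have hi4 : Integrable (fun y : ℝ => Complex.exp (Complex.I * ((u * y : ℝ) : ℂ)) - 1) (μ n) :=
      hi1.sub (integrable_const _)
    rw [integral_sub hi4 hi2, integral_sub hi1 (integrable_const _), hi3, charFun_real_eq]
    simp only [integral_const, hb]
    simp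
    ring
  have hbC : Tendsto (fun n => (b n : ℂ)) U
      (𝓝 (-Complex.I * (ψ 1 - ∫ y, K 1 y ∂(M₀ : Measure ℝ)))) := by
    have h1 := (((hlim 1).mono_left hUle).sub (hMlim (K 1))).const_mul (-Complex.I)
    refine h1.congr fun n => ?_
    rw [hdrift 1 n, add_sub_cancel_right, one_mul, ← mul_assoc, neg_mul, Complex.I_mul_I, neg_neg,
      one_mul]
  obtain ⟨γ, hγ⟩ : ∃ γ : ℝ, Tendsto b U (𝓝 γ) := by
    exact ⟨_, ((Complex.continuous_re.tendsto _).comp hbC).congr fun n => Complex.ofReal_re _⟩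
  refine ⟨M₀, γ, inferInstance, hMχ, fun u => ?_⟩
  refine tendsto_nhds_unique ((hlim u).mono_left hUle) ?_
  simp only [hdrift]
  refine Tendsto.add (Tendsto.const_mul _ ?_) (hMlim (K u))
  exact (Complex.continuous_ofReal.tendsto _).comp (hγ.const_mul u)

end LevyKhintchineLimit

end CylLevy

namespace CylLevy

/-! ### Extension of a bimeasure -/

section Bimeasure

variable {X : Type*} [MeasurableSpace X]

theorem sectionMeasure_apply (M : Measure (X × ℝ)) (A : Set X) {B : Set ℝ}
    (hB : MeasurableSet B) : sectionMeasure M A B = M (A ×ˢ B) := by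
  rw [sectionMeasure, Measure.map_apply measurable_snd hB,
    Measure.restrict_apply (measurable_snd hB)]
  congr 1
  ext ⟨x, y⟩
  simp [and_comm]

/-- The density at `B` of a bimeasure with respect to its marginal. -/
theorem isRatStieltjesPoint_of_density {f : Set ℝ → ℝ≥0∞} (hmono : ∀ q r : ℚ, q ≤ r →
      f (Set.Iic (q : ℝ)) ≤ f (Set.Iic (r : ℝ)))
    (hcompl : ∀ q : ℚ, f (Set.Iic (q : ℝ)) + f (Set.Ioi (q : ℝ)) = 1)
    (htop : ⨆ n : ℕ, f (Set.Iic (n : ℝ)) = 1)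
    (hbot : ⨆ n : ℕ, f (Set.Ioi (-(n : ℝ))) = 1)
    (hright : ∀ q : ℚ, ⨆ n : ℕ, f (Set.Ioi ((q : ℝ) + 1 / ((n : ℝ) + 1))) = f (Set.Ioi (q : ℝ)))
    {α : Type*} (a : α) :
    IsRatStieltjesPoint (fun (_ : α) (q : ℚ) => (f (Set.Iic (q : ℝ))).toReal) a := by
  have hle : ∀ q : ℚ, f (Set.Iic (q : ℝ)) ≤ 1 := fun q => (hcompl q) ▸ le_self_add
  have hle' : ∀ q : ℚ, f (Set.Ioi (q : ℝ)) ≤ 1 := fun q => (hcompl q) ▸ le_add_self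
  have hF : ∀ q : ℚ, (f (Set.Iic (q : ℝ))).toReal = 1 - (f (Set.Ioi (q : ℝ))).toReal := by
    intro q
    have h := congrArg ENNReal.toReal (hcompl q)
    rw [ENNReal.toReal_add ((hle q).trans_lt ENNReal.one_lt_top).ne
      ((hle' q).trans_lt ENNReal.one_lt_top).ne, ENNReal.toReal_one] at h
    linarith
  have hFmono : Monotone fun q : ℚ => (f (Set.Iic (q : ℝ))).toReal := fun q r hqr =>
    ENNReal.toReal_mono ((hle r).trans_lt ENNReal.one_lt_top).ne (hmono q r hqr)
  have hanti : Antitone fun q : ℚ => f (Set.Ioi (q : ℝ)) := by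
    intro q r hqr
    have h1 := hFmono hqr
    simp only [hF] at h1
    exact (ENNReal.toReal_le_toReal ((hle' r).trans_lt ENNReal.one_lt_top).ne
      ((hle' q).trans_lt ENNReal.one_lt_top).ne).1 (by linarith)
  refine ⟨hFmono, ?_, ?_, ?_⟩
  · have h1 : Tendsto (fun q : ℚ => f (Set.Iic (q : ℝ))) atTop (𝓝 1) := by
      have : ⨆ q : ℚ, f (Set.Iic (q : ℝ)) = 1 := by
        refine le_antisymm (iSup_le hle) ?_
        rw [← htop]
        refine iSup_le fun n => ?_
        have := le_iSup (fun q : ℚ => f (Set.Iic (q : ℝ))) (n : ℚ)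
        simpa using this
      rw [← this]
      exact tendsto_atTop_iSup fun q r h => hmono q r h
    exact (ENNReal.tendsto_toReal ENNReal.one_ne_top).comp h1
  · have h1 : Tendsto (fun q : ℚ => f (Set.Ioi (q : ℝ))) atBot (𝓝 1) := by
      have : ⨆ q : ℚ, f (Set.Ioi (q : ℝ)) = 1 := by
        refine le_antisymm (iSup_le hle') ?_
        rw [← hbot]
        refine iSup_le fun n => ?_
        have := le_iSup (fun q : ℚ => f (Set.Ioi (q : ℝ))) (-(n : ℚ))
        simpa using this
      rw [← this]
      exact tendsto_atBot_iSup hanti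
    have h2 := ((ENNReal.tendsto_toReal ENNReal.one_ne_top).comp h1).const_sub 1
    simp only [ENNReal.toReal_one, sub_self] at h2
    exact h2.congr fun q => (hF q).symm
  · intro t
    refine le_antisymm ?_ (le_ciInf fun r => hFmono r.2.le)
    have hbdd : BddBelow (Set.range fun r : Set.Ioi t => (f (Set.Iic ((r : ℚ) : ℝ))).toReal) :=
      ⟨0, by rintro _ ⟨r, rfl⟩; exact ENNReal.toReal_nonneg⟩
    have hcast : ∀ n : ℕ, ((t + 1 / ((n : ℚ) + 1) : ℚ) : ℝ) = (t : ℝ) + 1 / ((n : ℝ) + 1) := by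
      intro n; push_cast; rfl
    have h1 : Tendsto (fun n : ℕ => f (Set.Ioi ((t : ℝ) + 1 / ((n : ℝ) + 1)))) atTop
        (𝓝 (f (Set.Ioi (t : ℝ)))) := by
      rw [← hright t]
      refine tendsto_atTop_iSup fun m n hmn => ?_
      simp only [← hcast]
      refine hanti ?_
      gcongr
    have h2 := ((ENNReal.tendsto_toReal ((hle' t).trans_lt ENNReal.one_lt_top).ne).comp
      h1).const_sub 1
    rw [← hF t] at h2
    refine ge_of_tendsto' h2 fun n => ?_
    have h3 : (f (Set.Iic ((t + 1 / ((n : ℚ) + 1) : ℚ) : ℝ))).toReal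
        = 1 - (f (Set.Ioi ((t : ℝ) + 1 / ((n : ℝ) + 1)))).toReal := by
      rw [hF, hcast]
    simp only [Function.comp]
    rw [← h3]
    exact ciInf_le hbdd ⟨t + 1 / ((n : ℚ) + 1), by
      have : (0 : ℚ) < 1 / ((n : ℚ) + 1) := by positivity
      simpa using this⟩

/-- A `σ`-additive family of measures `m A` on the line, indexed by the measurable subsets `A` of
`X`, is given by the sections of a measure on `X × ℝ`. -/
theorem exists_measure_prod_of_bimeasure (m : Set X → Measure ℝ) (hm0 : m ∅ = 0)
    (hm : ∀ A : ℕ → Set X, (∀ i, MeasurableSet (A i)) → Pairwise (Function.onFun Disjoint A) →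
      m (⋃ i, A i) = Measure.sum fun i => m (A i))
    (D : ℕ → Set X) (hD : ∀ n, MeasurableSet (D n)) (hDfin : ∀ n, m (D n) Set.univ < ∞)
    (hDU : ⋃ n, D n = Set.univ) :
    ∃ M : Measure (X × ℝ), SigmaFinite M ∧
      ∀ A, MeasurableSet A → m A Set.univ < ∞ → sectionMeasure M A = m A := by
  have hlam : ∀ B : Set ℝ, MeasurableSet B → ∃ l : Measure X, ∀ A, MeasurableSet A → l A = m A B :=
    fun B hB => ⟨Measure.ofMeasurable (fun A _ => m A B) (by simp [hm0]) (fun A hA hd => by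
      rw [hm A hA hd, Measure.sum_apply _ hB]), fun A hA => Measure.ofMeasurable_apply A hA⟩
  choose! lam hlam using hlam
  set l := lam Set.univ with hl
  have hlA : ∀ A, MeasurableSet A → l A = m A Set.univ := hlam _ MeasurableSet.univ
  have hsf : SigmaFinite l := by
    refine ⟨⟨⟨D, fun _ => trivial, fun n => ?_, hDU⟩⟩⟩
    rw [hlA _ (hD n)]
    exact hDfin n
  have hle : ∀ B, MeasurableSet B → lam B ≤ l := fun B hB =>
    Measure.le_intro fun A hA _ => by
      rw [hlam B hB A hA, hlA A hA]
      exact measure_mono (Set.subset_univ _)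
  set f : Set ℝ → X → ℝ≥0∞ := fun B => (lam B).rnDeriv l with hf
  have hfm : ∀ B, Measurable (f B) := fun B => Measure.measurable_rnDeriv _ _
  have hfint : ∀ B, MeasurableSet B → ∀ A, MeasurableSet A → ∫⁻ x in A, f B x ∂l = m A B := by
    intro B hB A hA
    have hsfB : SigmaFinite (lam B) := by
      refine ⟨⟨⟨D, fun _ => trivial, fun n => ?_, hDU⟩⟩⟩
      rw [hlam B hB _ (hD n)]
      exact (measure_mono (Set.subset_univ _)).trans_lt (hDfin n)
    rw [← withDensity_apply _ hA, Measure.withDensity_rnDeriv_eq _ _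
      (Measure.absolutelyContinuous_of_le (hle B hB)), hlam B hB A hA]
  have hfuniv : f Set.univ =ᵐ[l] fun _ => 1 := Measure.rnDeriv_self l
  have hfmono : ∀ B C, MeasurableSet B → MeasurableSet C → B ⊆ C → f B ≤ᵐ[l] f C := by
    intro B C hB hC hBC
    refine ae_le_of_forall_setLIntegral_le_of_sigmaFinite (hfm B) fun A hA _ => ?_
    rw [hfint B hB A hA, hfint C hC A hA]
    exact measure_mono hBC
  have hfsup : ∀ B : ℕ → Set ℝ, (∀ n, MeasurableSet (B n)) → Monotone B →
      (fun x => ⨆ n, f (B n) x) =ᵐ[l] f (⋃ n, B n) := by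
    intro B hB hBm
    refine ae_eq_of_forall_setLIntegral_eq_of_sigmaFinite (.iSup fun n => hfm _) (hfm _)
      fun A hA _ => ?_
    rw [lintegral_iSup' (fun n => (hfm _).aemeasurable), hfint _ (.iUnion hB) A hA,
      hBm.measure_iUnion]
    · simp only [hfint _ (hB _) A hA]
    · have : ∀ᵐ x ∂l, ∀ n, f (B n) x ≤ f (B (n + 1)) x :=
        ae_all_iff.2 fun n => hfmono _ _ (hB n) (hB _) (hBm n.le_succ)
      filter_upwards [ae_restrict_of_ae this] with x hx
      exact monotone_nat_of_le_succ hx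
  have hfcompl : ∀ B, MeasurableSet B → ∀ᵐ x ∂l, f B x + f Bᶜ x = 1 := by
    intro B hB
    have : (fun x => f B x + f Bᶜ x) =ᵐ[l] f Set.univ := by
      refine ae_eq_of_forall_setLIntegral_eq_of_sigmaFinite ((hfm _).add (hfm _)) (hfm _)
        fun A hA _ => ?_
      rw [lintegral_add_left (hfm _), hfint _ hB A hA, hfint _ hB.compl A hA,
        hfint _ MeasurableSet.univ A hA, measure_add_measure_compl hB]
    filter_upwards [this, hfuniv] with x hx hx'
    rw [hx, hx']
  set F : X → ℚ → ℝ := fun x q => (f (Set.Iic (q : ℝ)) x).toReal with hF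
  have hFm : Measurable F := measurable_pi_iff.2 fun q => (hfm _).ennreal_toReal
  have hFst : ∀ᵐ x ∂l, IsRatStieltjesPoint F x := by
    have h1 : ∀ᵐ x ∂l, ∀ q r : ℚ, q ≤ r → f (Set.Iic (q : ℝ)) x ≤ f (Set.Iic (r : ℝ)) x := by
      simp only [ae_all_iff]
      intro q r hqr
      exact hfmono _ _ measurableSet_Iic measurableSet_Iic
        (Set.Iic_subset_Iic.2 (by exact_mod_cast hqr))
    have h2 : ∀ᵐ x ∂l, ∀ q : ℚ, f (Set.Iic (q : ℝ)) x + f (Set.Ioi (q : ℝ)) x = 1 := by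
      rw [ae_all_iff]
      intro q
      simpa using hfcompl (Set.Iic (q : ℝ)) measurableSet_Iic
    have h3 := hfsup (fun n => Set.Iic (n : ℝ)) (fun n => measurableSet_Iic)
      (fun a b hab => Set.Iic_subset_Iic.2 (by exact_mod_cast hab))
    have h4 := hfsup (fun n => Set.Ioi (-(n : ℝ))) (fun n => measurableSet_Ioi)
      (fun a b hab => Set.Ioi_subset_Ioi (by simpa using hab))
    have h5 : ∀ᵐ x ∂l, ∀ q : ℚ, ⨆ n : ℕ, f (Set.Ioi ((q : ℝ) + 1 / ((n : ℝ) + 1))) x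
        = f (Set.Ioi (q : ℝ)) x := by
      rw [ae_all_iff]
      intro q
      have h := hfsup (fun n => Set.Ioi ((q : ℝ) + 1 / ((n : ℝ) + 1))) (fun n => measurableSet_Ioi)
        (fun a b hab => Set.Ioi_subset_Ioi (by gcongr))
      have hU : ⋃ n : ℕ, Set.Ioi ((q : ℝ) + 1 / ((n : ℝ) + 1)) = Set.Ioi (q : ℝ) := by
        ext y
        simp only [Set.mem_iUnion, Set.mem_Ioi]
        constructor
        · rintro ⟨n, hn⟩
          have : (0 : ℝ) < 1 / ((n : ℝ) + 1) := by positivity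
          linarith
        · intro hy
          obtain ⟨n, hn⟩ := exists_nat_one_div_lt (sub_pos.2 hy)
          exact ⟨n, by linarith⟩
      rw [hU] at h
      exact h
    have hU3 : ⋃ n : ℕ, Set.Iic (n : ℝ) = Set.univ := by
      ext y
      simpa using exists_nat_ge y
    have hU4 : ⋃ n : ℕ, Set.Ioi (-(n : ℝ)) = Set.univ := by
      ext y
      obtain ⟨n, hn⟩ := exists_nat_gt (-y)
      simpa using ⟨n, by linarith⟩
    rw [hU3] at h3
    rw [hU4] at h4
    filter_upwards [h1, h2, h3, h4, h5, hfuniv] with x h1 h2 h3 h4 h5 h6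
    rw [h6] at h3 h4
    have h7 := isRatStieltjesPoint_of_density (f := fun B => f B x) h1 h2 h3 h4 h5 x
    exact ⟨h7.1, h7.2, h7.3, h7.4⟩
  have hcdf := isMeasurableRatCDF_toRatCDF hFm
  set κ : Kernel X ℝ := ⟨fun x => (hcdf.stieltjesFunction x).measure,
    hcdf.measurable_measure_stieltjesFunction⟩ with hκ
  have hκM : IsMarkovKernel κ := ⟨fun x => by
    change IsProbabilityMeasure (hcdf.stieltjesFunction x).measure
    infer_instance⟩
  have hMprod : ∀ A B, MeasurableSet A → MeasurableSet B →
      (l ⊗ₘ κ) (A ×ˢ B) = ∫⁻ x in A, κ x B ∂l := fun A B hA hB =>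
    Measure.compProd_apply_prod hA hB
  refine ⟨l ⊗ₘ κ, ?_, fun A hA hAfin => ?_⟩
  · refine ⟨⟨⟨fun n => D n ×ˢ Set.univ, fun _ => trivial, fun n => ?_, ?_⟩⟩⟩
    · rw [hMprod _ _ (hD n) MeasurableSet.univ]
      simp only [measure_univ, setLIntegral_one]
      rw [hlA _ (hD n)]
      exact hDfin n
    · rw [← Set.iUnion_prod_const, hDU, Set.univ_prod_univ]
  · have huniv : sectionMeasure (l ⊗ₘ κ) A Set.univ = m A Set.univ := by
      rw [sectionMeasure_apply _ A MeasurableSet.univ, hMprod _ _ hA MeasurableSet.univ]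
      simp only [measure_univ, setLIntegral_one]
      exact hlA A hA
    have : IsFiniteMeasure (sectionMeasure (l ⊗ₘ κ) A) := ⟨by rwa [huniv]⟩
    refine ext_of_generate_finite _ (BorelSpace.measurable_eq.trans
      Real.borel_eq_generateFrom_Iic_rat) Real.isPiSystem_Iic_rat ?_ huniv
    intro B hB
    obtain ⟨q, rfl⟩ : ∃ q : ℚ, B = Set.Iic (q : ℝ) := by simpa [eq_comm] using hB
    rw [sectionMeasure_apply _ A measurableSet_Iic, hMprod _ _ hA measurableSet_Iic,
      ← hfint _ measurableSet_Iic A hA]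
    refine lintegral_congr_ae (ae_restrict_of_ae ?_)
    filter_upwards [hFst, hfmono (Set.Iic (q : ℝ)) Set.univ measurableSet_Iic MeasurableSet.univ
      (Set.subset_univ _), hfuniv] with x hx hx1 hx2
    have h1 : κ x (Set.Iic (q : ℝ)) = ENNReal.ofReal (hcdf.stieltjesFunction x q) :=
      hcdf.measure_stieltjesFunction_Iic x q
    rw [h1, hcdf.stieltjesFunction_eq, toRatCDF_of_isRatStieltjesPoint hx]
    refine ENNReal.ofReal_toReal ?_
    rw [hx2] at hx1
    exact (hx1.trans_lt ENNReal.one_lt_top).ne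

end Bimeasure

end CylLevy

namespace CylLevy

/-! ### Independence in terms of the symbol -/

section Independence

variable {Ω X : Type*} [MeasurableSpace Ω] [MeasurableSpace X] {P : Measure Ω}
  {ζ : Measure X} {q : ℝ≥0∞}
  {L : ℝ≥0 → Lp ℝ q ζ →ₗ[ℝ] (Ω →ₘ[P] ℝ)} {Ψ : Lp ℝ q ζ → ℂ}

theorem coeFn_map_sum_smul {n : ℕ} (t : ℝ≥0) (u : Fin n → ℝ) (g : Fin n → Lp ℝ q ζ) :
    ∀ᵐ ω ∂P, L t (∑ k, u k • g k) ω = ∑ k, u k * L t (g k) ω := by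
  have h1 : L t (∑ k, u k • g k) = ∑ k, u k • L t (g k) := by simp
  have h2 : ∀ s : Finset (Fin n),
      ∀ᵐ ω ∂P, (∑ k ∈ s, u k • L t (g k) : Ω →ₘ[P] ℝ) ω = ∑ k ∈ s, u k * L t (g k) ω := by
    intro s
    induction s using Finset.induction_on with
    | empty =>
      filter_upwards [AEEqFun.coeFn_zero (α := Ω) (β := ℝ) (μ := P)] with ω hω
      simp [hω]
    | insert a s ha ih =>
      rw [Finset.sum_insert ha]
      filter_upwards [ih, AEEqFun.coeFn_add (u a • L t (g a)) (∑ k ∈ s, u k • L t (g k)),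
        AEEqFun.coeFn_smul (u a) (L t (g a))] with ω h1 h2 h3
      rw [h2, Pi.add_apply, h3, h1, Finset.sum_insert ha]
      rfl
  rw [h1]
  exact h2 Finset.univ

variable [Fact (1 ≤ q)]

theorem IsSymbol.charFun_map (hΨ : IsSymbol P ζ q L Ψ) (t : ℝ≥0) (g : Lp ℝ q ζ) (u : ℝ) :
    charFun (P.map fun ω => L t g ω) u = Complex.exp (((t : ℝ) : ℂ) * Ψ (u • g)) := by
  rw [charFun_real_eq, integral_map (aemeasurable_apply t g) (by fun_prop), ← hΨ]
  refine integral_congr_ae ?_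
  rw [map_smul]
  filter_upwards [AEEqFun.coeFn_smul u (L t g)] with ω hω
  rw [hω]
  rfl

theorem IsSymbol.charFun_map_pi (hΨ : IsSymbol P ζ q L Ψ) {n : ℕ} (t : ℝ≥0)
    (g : Fin n → Lp ℝ q ζ) (u : EuclideanSpace ℝ (Fin n)) :
    charFun (P.map fun ω => WithLp.toLp 2 fun k => (L t (g k) ω : ℝ)) u =
      Complex.exp (((t : ℝ) : ℂ) * Ψ (∑ k, u k • g k)) := by
  have hm : AEMeasurable (fun ω => WithLp.toLp 2 fun k => (L t (g k) ω : ℝ)) P := by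
    have : AEMeasurable (fun ω k => (L t (g k) ω : ℝ)) P :=
      aemeasurable_pi_lambda _ fun k => aemeasurable_apply t (g k)
    fun_prop
  rw [charFun_apply, integral_map hm (by fun_prop), ← hΨ]
  refine integral_congr_ae ?_
  filter_upwards [coeFn_map_sum_smul t (fun k => u k) g] with ω hω
  rw [hω, mul_comm Complex.I]
  simp [PiLp.inner_apply]

variable [IsProbabilityMeasure P]

theorem IsSymbol.iIndepFun_iff (hΨ : IsSymbol P ζ q L Ψ) {n : ℕ} (g : Fin n → Lp ℝ q ζ) :
    (∀ t : ℝ≥0, iIndepFun (fun (k : Fin n) (ω : Ω) => L t (g k) ω) P) ↔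
      ∀ u : Fin n → ℝ, Ψ (∑ k, u k • g k) = ∑ k, Ψ (u k • g k) := by
  have h : ∀ t : ℝ≥0, iIndepFun (fun (k : Fin n) (ω : Ω) => L t (g k) ω) P ↔
      ∀ u : EuclideanSpace ℝ (Fin n), Complex.exp (((t : ℝ) : ℂ) * Ψ (∑ k, u k • g k)) =
        Complex.exp (((t : ℝ) : ℂ) * ∑ k, Ψ (u k • g k)) := by
    intro t
    rw [iIndepFun_iff_charFun_pi fun k => aemeasurable_apply t (g k)]
    refine forall_congr' fun u => ?_
    simp only [hΨ.charFun_map, Finset.mul_sum, Complex.exp_sum]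
    rw [hΨ.charFun_map_pi]
  constructor
  · intro hind u
    refine eq_of_forall_exp_mul_eq fun t => ?_
    exact (h t).1 (hind t) (WithLp.toLp 2 u)
  · intro hΨu t
    refine (h t).2 fun u => ?_
    rw [hΨu]

end Independence

/-! ### The local part of the symbol -/

section LocalForm

theorem _root_.MeasureTheory.MemLp.toLp_finset_sum {ι X : Type*} [MeasurableSpace X] {ζ : Measure X}
    {q : ℝ≥0∞} (s : Finset ι) {f : ι → X → ℝ} (hf : ∀ i, MemLp (f i) q ζ)
    (h : MemLp (fun x => ∑ i ∈ s, f i x) q ζ) :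
    h.toLp _ = ∑ i ∈ s, (hf i).toLp (f i) := by
  classical
  induction s using Finset.induction_on with
  | empty =>
    simp only [Finset.sum_empty]
    exact (MemLp.toLp_eq_toLp_iff h (MemLp.zero' (p := q))).2 (by simp)
  | insert a s ha ih =>
    have hs : MemLp (fun x => ∑ i ∈ s, f i x) q ζ := memLp_finsetSum s fun i _ => hf i
    rw [Finset.sum_insert ha, ← ih hs, ← MemLp.toLp_add (hf a) hs]
    refine (MemLp.toLp_eq_toLp_iff h _).2 (Eventually.of_forall fun x => ?_)
    simp [Finset.sum_insert ha]

variable {X : Type*}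

theorem norm_jumpIntegrand_le (f : X → ℝ) (z : X × ℝ) :
    ‖jumpIntegrand f z‖ ≤ (3 * f z.1 ^ 2 + 2) * min 1 (z.2 ^ 2) := by
  by_cases h : z.2 ∈ Set.Icc (-1 : ℝ) 1
  · have h2 : z.2 ^ 2 ≤ 1 := by nlinarith [h.1, h.2]
    rw [jumpIntegrand, Set.indicator_of_mem h, Pi.one_apply, mul_one, min_eq_right h2]
    refine (norm_exp_I_mul_sub_one_sub_le _).trans ?_
    nlinarith [sq_nonneg z.2]
  · have h2 : 1 ≤ z.2 ^ 2 := by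
      by_contra! hlt
      exact h (abs_le.1 (abs_le_one_iff_mul_self_le_one.2 (by nlinarith)))
    rw [jumpIntegrand, Set.indicator_of_notMem h, min_eq_left h2]
    simp only [mul_zero, Complex.ofReal_zero, sub_zero, mul_one]
    refine (norm_exp_I_mul_sub_one_le _).trans ?_
    nlinarith [sq_nonneg (f z.1)]

theorem jumpIntegrand_of_eq_zero {f : X → ℝ} {z : X × ℝ} (h : f z.1 = 0) :
    jumpIntegrand f z = 0 := by simp [jumpIntegrand, h]

theorem jumpIntegrand_congr {f g : X → ℝ} {z : X × ℝ} (h : f z.1 = g z.1) :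
    jumpIntegrand f z = jumpIntegrand g z := by simp [jumpIntegrand, h]

theorem jumpIntegrand_sum {ι : Type*} (s : Finset ι) {f : ι → X → ℝ} {z : X × ℝ}
    (hd : ∀ i ∈ s, ∀ j ∈ s, i ≠ j → f i z.1 = 0 ∨ f j z.1 = 0) :
    jumpIntegrand (fun x => ∑ i ∈ s, f i x) z = ∑ i ∈ s, jumpIntegrand (f i) z := by
  by_cases h : ∃ i ∈ s, f i z.1 ≠ 0
  · obtain ⟨i, hi, hne⟩ := h
    have h0 : ∀ j ∈ s, j ≠ i → f j z.1 = 0 := fun j hj hji =>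
      (hd j hj i hi hji).resolve_right hne
    rw [Finset.sum_eq_single_of_mem i hi fun j hj hji => jumpIntegrand_of_eq_zero (h0 j hj hji)]
    exact jumpIntegrand_congr (Finset.sum_eq_single_of_mem i hi h0)
  · push Not at h
    rw [Finset.sum_eq_zero fun j hj => jumpIntegrand_of_eq_zero (h j hj)]
    exact jumpIntegrand_of_eq_zero (Finset.sum_eq_zero h)

variable [MeasurableSpace X]

theorem measurable_jumpIntegrand {f : X → ℝ} (hf : Measurable f) :
    Measurable (jumpIntegrand f) := by
  have h : Measurable (Set.indicator (Set.Icc (-1 : ℝ) 1) (1 : ℝ → ℝ)) :=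
    measurable_one.indicator measurableSet_Icc
  unfold jumpIntegrand
  fun_prop

variable [TopologicalSpace X]

theorem IsRelCompactBorel.union {A B : Set X} (hA : IsRelCompactBorel A)
    (hB : IsRelCompactBorel B) : IsRelCompactBorel (A ∪ B) :=
  ⟨hA.1.union hB.1, by rw [closure_union]; exact hA.2.union hB.2⟩

theorem IsRelCompactBorel.empty : IsRelCompactBorel (∅ : Set X) := ⟨.empty, by simp⟩

theorem IsRelCompactBorel.mono [T2Space X] {A B : Set X} (hA : IsRelCompactBorel A)
    (hB : MeasurableSet B) (hBA : B ⊆ A) : IsRelCompactBorel B :=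
  ⟨hB, hA.2.of_isClosed_subset isClosed_closure (closure_mono hBA)⟩

instance (f : X → ℝ) : Nonempty (BddSets f) := ⟨⟨∅, IsRelCompactBorel.empty, 0, by simp⟩⟩

instance (f : X → ℝ) : IsDirectedOrder (BddSets f) :=
  ⟨fun A B => by
    obtain ⟨a, ha⟩ := A.2.2
    obtain ⟨b, hb⟩ := B.2.2
    refine ⟨⟨A.1 ∪ B.1, A.2.1.union B.2.1, max a b, ?_⟩, Set.subset_union_left,
      Set.subset_union_right⟩
    rintro x (hx | hx)
    · exact (ha x hx).trans (le_max_left _ _)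
    · exact (hb x hx).trans (le_max_right _ _)⟩

theorem Characteristics.integrableOn_min (c : Characteristics X) {A : Set X}
    (hA : IsRelCompactBorel A) :
    IntegrableOn (fun z : X × ℝ => min 1 (z.2 ^ 2)) (A ×ˢ Set.univ) c.ν := by
  refine ⟨Measurable.aestronglyMeasurable (by fun_prop), ?_⟩
  have h := (c.isLevyMeasure A hA).2
  rw [sectionMeasure, lintegral_map (by fun_prop) measurable_snd] at h
  refine lt_of_eq_of_lt (lintegral_congr fun z => ?_) h
  rw [Real.enorm_of_nonneg (by positivity)]

theorem Characteristics.integrableOn_jumpIntegrand (c : Characteristics X) {A : Set X}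
    (hA : IsRelCompactBorel A) {f : X → ℝ} (hf : Measurable f) {C : ℝ}
    (hC : ∀ x ∈ A, |f x| ≤ C) : IntegrableOn (jumpIntegrand f) (A ×ˢ Set.univ) c.ν := by
  refine ((c.integrableOn_min hA).const_mul (3 * C ^ 2 + 2)).mono'
    (measurable_jumpIntegrand hf).aestronglyMeasurable ?_
  filter_upwards [ae_restrict_mem (hA.1.prod .univ)] with z hz
  refine (norm_jumpIntegrand_le f z).trans ?_
  have := hC z.1 hz.1
  have h2 : f z.1 ^ 2 ≤ C ^ 2 := by
    rw [← sq_abs]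
    exact pow_le_pow_left₀ (abs_nonneg _) this 2
  gcongr

variable [T2Space X]

theorem LocalSignedMeasure.ae_mem_variation (γ : LocalSignedMeasure X) {A : Set X}
    (hA : IsRelCompactBorel A) : ∀ᵐ x ∂(γ.restrict hA).variation, x ∈ A := by
  change (γ.restrict hA).variation Aᶜ = 0
  rw [VectorMeasure.variation_apply_eq_zero hA.1.compl]
  intro t ht htm
  rw [γ.restrict_apply hA htm, (disjoint_compl_right.mono_right ht).inter_eq, γ.empty]

instance (γ : LocalSignedMeasure X) {A : Set X} (hA : IsRelCompactBorel A) :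
    IsFiniteMeasure (γ.restrict hA).variation := by
  rw [← SignedMeasure.totalVariation_eq_variation]
  infer_instance

theorem LocalSignedMeasure.integrable_restrict (γ : LocalSignedMeasure X) {A : Set X}
    (hA : IsRelCompactBorel A) {f : X → ℝ} (hf : Measurable f) {C : ℝ}
    (hC : ∀ x ∈ A, |f x| ≤ C) : (γ.restrict hA).Integrable f := by
  refine Integrable.of_bound (C := C) hf.aestronglyMeasurable ?_
  filter_upwards [γ.ae_mem_variation hA] with x hx
  exact hC x hx

theorem LocalSignedMeasure.setIntegral_indicator (γ : LocalSignedMeasure X) {A B : Set X}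
    (hA : IsRelCompactBorel A) (hB : MeasurableSet B) (u : ℝ) :
    γ.setIntegral hA (B.indicator fun _ => u) = u * γ.toFun (A ∩ B) := by
  rw [LocalSignedMeasure.setIntegral, VectorMeasure.integral_indicator_const u hB,
    γ.restrict_apply hA hB]
  simp

theorem LocalSignedMeasure.setIntegral_sum (γ : LocalSignedMeasure X) {A : Set X}
    (hA : IsRelCompactBorel A) {ι : Type*} (s : Finset ι) {f : ι → X → ℝ}
    (hf : ∀ i, Measurable (f i)) (hC : ∀ i, ∃ C, ∀ x ∈ A, |f i x| ≤ C) :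
    γ.setIntegral hA (fun x => ∑ i ∈ s, f i x) = ∑ i ∈ s, γ.setIntegral hA (f i) := by
  simp only [LocalSignedMeasure.setIntegral]
  rw [← VectorMeasure.integral_finsetSum s fun i _ =>
    γ.integrable_restrict hA (hf i) (hC i).choose_spec]

/-- The contribution of a relatively compact set to the drift and jump parts of the symbol. -/
noncomputable def Characteristics.localForm (c : Characteristics X) {A : Set X}
    (hA : IsRelCompactBorel A) (f : X → ℝ) : ℂ :=
  Complex.I * ((c.γ.setIntegral hA f : ℝ) : ℂ) + ∫ z in A ×ˢ Set.univ, jumpIntegrand f z ∂c.ν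

theorem Characteristics.localForm_sum (c : Characteristics X) {A : Set X}
    (hA : IsRelCompactBorel A) {ι : Type*} (s : Finset ι) {f : ι → X → ℝ}
    (hf : ∀ i, Measurable (f i)) (hC : ∀ i, ∃ C, ∀ x ∈ A, |f i x| ≤ C)
    (hd : ∀ x, ∀ i ∈ s, ∀ j ∈ s, i ≠ j → f i x = 0 ∨ f j x = 0) :
    c.localForm hA (fun x => ∑ i ∈ s, f i x) = ∑ i ∈ s, c.localForm hA (f i) := by
  simp only [Characteristics.localForm]
  rw [c.γ.setIntegral_sum hA s hf hC, Finset.sum_add_distrib, Complex.ofReal_sum, Finset.mul_sum,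
    ← integral_finsetSum s fun i _ => c.integrableOn_jumpIntegrand hA (hf i) (hC i).choose_spec]
  simp only [jumpIntegrand_sum s (hd _)]

end LocalForm

end CylLevy

namespace CylLevy

/-! ### Symbols of the given form are independently scattered -/

section Converse

theorem smul_indicatorLp {X : Type*} [TopologicalSpace X] [MeasurableSpace X] {ζ : Measure X}
    [IsLocallyFiniteMeasure ζ] {q : ℝ≥0∞} {A : Set X} (hA : IsRelCompactBorel A) (u : ℝ)
    (h : MemLp (A.indicator fun _ => u) q ζ) : u • indicatorLp ζ q hA = h.toLp _ := by
  rw [indicatorLp, indicatorConstLp, ← MemLp.toLp_const_smul]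
  refine (MemLp.toLp_eq_toLp_iff _ _).2 (Eventually.of_forall fun x => ?_)
  by_cases hx : x ∈ A <;> simp [hx]

variable {X : Type*} [TopologicalSpace X] [MeasurableSpace X]

/-- The directed sets `BddSets` are cofinal in each other for bounded functions. -/
theorem tendsto_bddSets_of_bounded {f g : X → ℝ} (hf : ∃ C, ∀ x, |f x| ≤ C)
    (hg : ∃ C, ∀ x, |g x| ≤ C) :
    Tendsto (fun A : BddSets f => (⟨A.1, A.2.1, hg.imp fun _ h x _ => h x⟩ : BddSets g))
      atTop atTop := by
  refine tendsto_atTop.2 fun B => ?_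
  filter_upwards [eventually_ge_atTop
    (⟨B.1, B.2.1, hf.imp fun _ h x _ => h x⟩ : BddSets f)] with A hA
  exact hA

variable [T2Space X] {ζ : Measure X} {q : ℝ≥0∞}

theorem HasSymbolForm.apply_sum {c : Characteristics X} {Ψ : Lp ℝ q ζ → ℂ}
    (h : HasSymbolForm ζ q c Ψ) {ι : Type*} [Fintype ι] {f : ι → X → ℝ}
    (hf : ∀ i, Measurable (f i)) (hLp : ∀ i, MemLp (f i) q ζ) (hb : ∀ i, ∃ C, ∀ x, |f i x| ≤ C)
    (hd : ∀ x i j, i ≠ j → f i x = 0 ∨ f j x = 0) :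
    Ψ (∑ i, (hLp i).toLp (f i)) = ∑ i, Ψ ((hLp i).toLp (f i)) := by
  set g : X → ℝ := fun x => ∑ i, f i x with hg
  have hgm : Measurable g := Finset.measurable_sum _ fun i _ => hf i
  have hgLp : MemLp g q ζ := memLp_finsetSum _ fun i _ => hLp i
  have hgb : ∃ C, ∀ x, |g x| ≤ C := by
    choose C hC using hb
    exact ⟨∑ i, C i, fun x => (Finset.abs_sum_le_sum_abs _ _).trans
      (Finset.sum_le_sum fun i _ => hC i x)⟩
  rw [← MemLp.toLp_finset_sum Finset.univ hLp hgLp]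
  obtain ⟨-, J, hJ, hΨJ⟩ := h g hgm hgLp
  have hi := fun i => h (f i) (hf i) (hLp i)
  choose hint Ji hJi hΨi using hi
  have hJsum : J = ∑ i, Ji i := by
    refine tendsto_nhds_unique hJ ?_
    have h1 := tendsto_finsetSum Finset.univ fun i _ =>
      (hJi i).comp (tendsto_bddSets_of_bounded hgb (hb i))
    refine h1.congr fun A => ?_
    exact (c.localForm_sum A.2.1 Finset.univ hf (fun i => (hb i).imp fun _ h x _ => h x)
      (fun x i _ j _ hij => hd x i j hij)).symm
  have hgauss : ∫ x, g x ^ 2 ∂c.gaussian = ∑ i, ∫ x, f i x ^ 2 ∂c.gaussian := by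
    rw [← integral_finsetSum _ fun i _ => hint i]
    refine integral_congr_ae (Eventually.of_forall fun x => ?_)
    simp only [hg]
    by_cases hx : ∃ i, f i x ≠ 0
    · obtain ⟨i, hi⟩ := hx
      have h0 : ∀ j, j ≠ i → f j x = 0 := fun j hji => (hd x j i hji).resolve_right hi
      rw [Finset.sum_eq_single i (fun j _ hj => h0 j hj) (by simp),
        Finset.sum_eq_single i (fun j _ hj => by rw [h0 j hj]; simp) (by simp)]
    · push Not at hx
      simp [hx]
  rw [hΨJ, hJsum, hgauss]
  simp only [hΨi]
  rw [Finset.sum_sub_distrib, Complex.ofReal_sum, Finset.mul_sum]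

variable {Ω : Type*} [MeasurableSpace Ω] {P : Measure Ω} [IsProbabilityMeasure P]
  [IsLocallyFiniteMeasure ζ] [Fact (1 ≤ q)]

theorem isIndependentlyScattered_of_hasSymbolForm {L : ℝ≥0 → Lp ℝ q ζ →ₗ[ℝ] (Ω →ₘ[P] ℝ)}
    {c : Characteristics X} {Ψ : Lp ℝ q ζ → ℂ} (hΨ : IsSymbol P ζ q L Ψ)
    (h : HasSymbolForm ζ q c Ψ) : IsIndependentlyScattered P ζ q L := by
  intro n A hA hd
  refine (hΨ.iIndepFun_iff _).2 fun u => ?_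
  have hLp : ∀ k, MemLp ((A k).indicator fun _ => u k) q ζ := fun k =>
    memLp_indicator_const q (hA k).1 (u k) (Or.inr ((hA k).measure_ne_top ζ))
  simp only [smul_indicatorLp (hA _) _ (hLp _)]
  refine h.apply_sum (fun k => measurable_const.indicator (hA k).1) hLp (fun k => ⟨|u k|, ?_⟩) ?_
  · intro x
    by_cases hx : x ∈ A k <;> simp [hx]
  · intro x i j hij
    by_cases hx : x ∈ A i
    · exact Or.inr (Set.indicator_of_notMem (Set.disjoint_left.1 (hd hij) hx) _)
    · exact Or.inl (Set.indicator_of_notMem hx _)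

end Converse

end CylLevy

namespace CylLevy

/-! ### Khintchine measures of the marginals -/

section Marginals

variable {Ω X : Type*} [MeasurableSpace Ω] [MeasurableSpace X] {P : Measure Ω}
  {ζ : Measure X} {q : ℝ≥0∞} {Ψ : Lp ℝ q ζ → ℂ}

/-- `M` and `γ` are the Khintchine measure and the drift of the functional `u ↦ Ψ (u • f)`. -/
structure HasKhintchine (Ψ : Lp ℝ q ζ → ℂ) (f : Lp ℝ q ζ) (M : Measure ℝ) (γ : ℝ) : Prop where
  isFinite : IsFiniteMeasure M
  charFun_eq : ∀ u, charFun M u = Ψ (u • f) - 1 / 2 * ∫ s in (-1 : ℝ)..1, Ψ ((u + s) • f)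
  apply_eq : ∀ u, Ψ (u • f) = Complex.I * ((u * γ : ℝ) : ℂ) + ∫ y, kernel u y ∂M

theorem integrable_kernel (M : Measure ℝ) [IsFiniteMeasure M] (u : ℝ) : Integrable (kernel u) M :=
  Integrable.of_bound (continuous_kernel u).aestronglyMeasurable _
    (Eventually.of_forall fun y => norm_kernel_le u y)

theorem HasKhintchine.measure_univ {f : Lp ℝ q ζ} {M : Measure ℝ} {γ : ℝ}
    (h : HasKhintchine Ψ f M γ) (h0 : Ψ 0 = 0) :
    (M.real Set.univ : ℂ) = -(1 / 2 * ∫ s in (-1 : ℝ)..1, Ψ (s • f)) := by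
  have := h.charFun_eq 0
  simpa [h0] using this

theorem HasKhintchine.drift_eq {f : Lp ℝ q ζ} {M : Measure ℝ} {γ : ℝ}
    (h : HasKhintchine Ψ f M γ) : (γ : ℂ) = -Complex.I * (Ψ f - ∫ y, kernel 1 y ∂M) := by
  have := h.apply_eq 1
  rw [one_smul, one_mul] at this
  rw [this, add_sub_cancel_right, ← mul_assoc, neg_mul, Complex.I_mul_I, neg_neg, one_mul]

variable [Fact (1 ≤ q)]

theorem HasKhintchine.add (hc : Continuous Ψ) {f g : Lp ℝ q ζ} {M N K : Measure ℝ} {γ δ η : ℝ}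
    (hf : HasKhintchine Ψ f M γ) (hg : HasKhintchine Ψ g N δ) (hfg : HasKhintchine Ψ (f + g) K η)
    (hadd : ∀ u : ℝ, Ψ (u • (f + g)) = Ψ (u • f) + Ψ (u • g)) : K = M + N ∧ η = γ + δ := by
  have := hf.isFinite
  have := hg.isFinite
  have := hfg.isFinite
  have hK : K = M + N := by
    refine Measure.ext_of_charFun (funext fun u => ?_)
    have h1 : charFun (M + N) u = charFun M u + charFun N u := by
      simp only [charFun_real_eq]
      refine integral_add_measure ?_ ?_ <;>
      · refine Integrable.of_bound (C := 1) (by fun_prop) (Eventually.of_forall fun y => ?_)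
        rw [mul_comm Complex.I, Complex.norm_exp_ofReal_mul_I]
    have hi : ∀ h : Lp ℝ q ζ, IntervalIntegrable (fun s : ℝ => Ψ ((u + s) • h)) volume (-1) 1 :=
      fun h => (hc.comp (by fun_prop)).intervalIntegrable _ _
    rw [h1, hf.charFun_eq, hg.charFun_eq, hfg.charFun_eq]
    simp only [hadd]
    rw [intervalIntegral.integral_add (hi f) (hi g)]
    ring
  refine ⟨hK, ?_⟩
  have h2 : (η : ℂ) = γ + δ := by
    rw [hf.drift_eq, hg.drift_eq, hfg.drift_eq, hK,
      integral_add_measure (integrable_kernel M 1) (integrable_kernel N 1)]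
    have := hadd 1
    simp only [one_smul] at this
    rw [this]
    ring
  exact_mod_cast h2

theorem tendsto_integral_smul_zero (hc : Continuous Ψ) (h0 : Ψ 0 = 0) :
    Tendsto (fun f => ∫ s in (-1 : ℝ)..1, Ψ (s • f)) (𝓝 0) (𝓝 0) := by
  rw [Metric.tendsto_nhds]
  intro ε hε
  have h1 := Metric.tendsto_nhds.1 (hc.tendsto 0) (ε / 4) (by positivity)
  rw [h0] at h1
  obtain ⟨δ, hδ, hball⟩ := Metric.eventually_nhds_iff.1 h1
  filter_upwards [Metric.ball_mem_nhds (0 : Lp ℝ q ζ) hδ] with f hf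
  rw [mem_ball_zero_iff] at hf
  rw [dist_zero_right]
  refine lt_of_le_of_lt (intervalIntegral.norm_integral_le_of_norm_le_const (C := ε / 4) ?_) ?_
  · intro s hs
    rw [Set.uIoc_of_le (by norm_num)] at hs
    have h2 : dist (s • f) 0 < δ := by
      rw [dist_zero_right, norm_smul]
      refine lt_of_le_of_lt (mul_le_of_le_one_left (norm_nonneg f) ?_) hf
      exact abs_le.2 ⟨hs.1.le, hs.2⟩
    simpa using (hball h2).le
  · norm_num
    linarith

variable {ι : Type*} {l : Filter ι} {f : ι → Lp ℝ q ζ} {M : ι → Measure ℝ} {γ : ι → ℝ}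

theorem HasKhintchine.tendsto_measure_univ (hc : Continuous Ψ) (h0 : Ψ 0 = 0)
    (h : ∀ i, HasKhintchine Ψ (f i) (M i) (γ i)) (hf : Tendsto f l (𝓝 0)) :
    Tendsto (fun i => (M i).real Set.univ) l (𝓝 0) := by
  have h1 := (((tendsto_integral_smul_zero hc h0).comp hf).const_mul (1 / 2)).neg
  rw [mul_zero, neg_zero] at h1
  have h2 : Tendsto (fun i => ((M i).real Set.univ : ℂ)) l (𝓝 0) :=
    h1.congr fun i => ((h i).measure_univ h0).symm
  simpa using ((Complex.continuous_re.tendsto _).comp h2).congr fun i => Complex.ofReal_re _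

theorem HasKhintchine.tendsto_drift (hc : Continuous Ψ) (h0 : Ψ 0 = 0)
    (h : ∀ i, HasKhintchine Ψ (f i) (M i) (γ i)) (hf : Tendsto f l (𝓝 0)) :
    Tendsto γ l (𝓝 0) := by
  have h1 : Tendsto (fun i => ∫ y, kernel 1 y ∂(M i)) l (𝓝 0) := by
    have h2 := (HasKhintchine.tendsto_measure_univ hc h0 h hf).const_mul
      (3 * (1 : ℝ) ^ 2 + (3 * (1 : ℝ) ^ 2 + 3 * |(1 : ℝ)| + 2) * (384 / 11))
    rw [mul_zero] at h2
    refine squeeze_zero_norm (fun i => ?_) h2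
    have := (h i).isFinite
    exact norm_integral_le_of_norm_le_const (Eventually.of_forall fun y => norm_kernel_le 1 y)
  have h3 : Tendsto (fun i => Ψ (f i)) l (𝓝 0) := by
    have := (hc.tendsto 0).comp hf
    rwa [h0] at this
  have h4 := (h3.sub h1).const_mul (-Complex.I)
  rw [sub_zero, mul_zero] at h4
  have h5 : Tendsto (fun i => (γ i : ℂ)) l (𝓝 0) := h4.congr fun i => ((h i).drift_eq).symm
  simpa using ((Complex.continuous_re.tendsto _).comp h5).congr fun i => Complex.ofReal_re _

theorem IsSymbol.exists_hasKhintchine [IsProbabilityMeasure P]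
    {L : ℝ≥0 → Lp ℝ q ζ →ₗ[ℝ] (Ω →ₘ[P] ℝ)} (hΨ : IsSymbol P ζ q L Ψ) (hc : Continuous Ψ)
    (f : Lp ℝ q ζ) : ∃ M γ, HasKhintchine Ψ f M γ := by
  have hprob : ∀ n : ℕ, IsProbabilityMeasure (P.map fun ω => L (1 / ((n : ℝ≥0) + 1)) f ω) :=
    fun n => Measure.isProbabilityMeasure_map (aemeasurable_apply _ f)
  obtain ⟨M, γ, h1, h2, h3⟩ := exists_levyKhintchine (ψ := fun u => Ψ (u • f))
    (hc.comp (by fun_prop)) (fun n => P.map fun ω => L (1 / ((n : ℝ≥0) + 1)) f ω) (fun n u => by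
      rw [hΨ.charFun_map]
      congr 1
      push_cast
      ring)
  exact ⟨M, γ, h1, h2, h3⟩

end Marginals

end CylLevy

namespace CylLevy

/-! ### Set functions on the relatively compact Borel sets -/

section SetFunctions

variable {X : Type*} [TopologicalSpace X] [MeasurableSpace X]

theorem IsRelCompactBorel.biUnion_finset {ι : Type*} (s : Finset ι) {A : ι → Set X}
    (hA : ∀ i, IsRelCompactBorel (A i)) : IsRelCompactBorel (⋃ i ∈ s, A i) := by
  classical
  induction s using Finset.induction_on with
  | empty => simpa using IsRelCompactBorel.empty
  | insert a s _ ih =>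
    rw [Finset.set_biUnion_insert]
    exact (hA a).union ih

variable {ζ : Measure X} [IsLocallyFiniteMeasure ζ] {q : ℝ≥0∞}

theorem indicatorLp_union {A B : Set X} (hA : IsRelCompactBorel A) (hB : IsRelCompactBorel B)
    (hd : Disjoint A B) :
    indicatorLp ζ q (hA.union hB) = indicatorLp ζ q hA + indicatorLp ζ q hB :=
  indicatorConstLp_disjoint_union hA.1 hB.1 (hA.measure_ne_top ζ) (hB.measure_ne_top ζ) hd 1

theorem tendsto_indicatorLp_zero [Fact (1 ≤ q)] (hq : q ≠ ∞) {ι : Type*} {l : Filter ι}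
    {R : ι → Set X} (hR : ∀ i, IsRelCompactBorel (R i)) (h : Tendsto (fun i => ζ (R i)) l (𝓝 0)) :
    Tendsto (fun i => indicatorLp ζ q (hR i)) l (𝓝 0) := by
  have hq0 : 0 < q.toReal :=
    ENNReal.toReal_pos (one_pos.trans_le (Fact.out : 1 ≤ q)).ne' hq
  have h1 : Tendsto (fun i => ‖(1 : ℝ)‖ * ζ.real (R i) ^ (1 / q.toReal)) l (𝓝 0) := by
    have h2 : Tendsto (fun i => ζ.real (R i)) l (𝓝 0) := by
      simpa [Measure.real, Function.comp_def] using
        (ENNReal.tendsto_toReal ENNReal.zero_ne_top).comp h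
    have h3 := (h2.rpow_const (p := 1 / q.toReal) (Or.inr (by positivity))).const_mul ‖(1 : ℝ)‖
    rwa [Real.zero_rpow (by positivity), mul_zero] at h3
  exact squeeze_zero_norm (fun i => norm_indicatorConstLp_le) h1

theorem hasSum_of_additive [T2Space X] {v : Set X → ℝ}
    (hadd : ∀ A B, IsRelCompactBorel A → IsRelCompactBorel B → Disjoint A B →
      v (A ∪ B) = v A + v B)
    (hcont : ∀ R : Finset ℕ → Set X, (∀ s, IsRelCompactBorel (R s)) →
      Tendsto (fun s => ζ (R s)) atTop (𝓝 0) → Tendsto (fun s => v (R s)) atTop (𝓝 0))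
    {A : ℕ → Set X} (hA : ∀ i, IsRelCompactBorel (A i))
    (hd : Pairwise fun i j => Disjoint (A i) (A j)) (hU : IsRelCompactBorel (⋃ i, A i)) :
    HasSum (fun i => v (A i)) (v (⋃ i, A i)) := by
  classical
  have h0 : v ∅ = 0 := by
    have := hadd ∅ ∅ .empty .empty (Set.disjoint_empty _)
    rw [Set.union_empty] at this
    linarith
  have hfin : ∀ s : Finset ℕ, v (⋃ i ∈ s, A i) = ∑ i ∈ s, v (A i) := by
    intro s
    induction s using Finset.induction_on with
    | empty => simpa using h0
    | insert a s ha ih =>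
      rw [Finset.set_biUnion_insert, Finset.sum_insert ha, ← ih]
      refine hadd _ _ (hA a) (.biUnion_finset s hA) ?_
      rw [Set.disjoint_iUnion₂_right]
      exact fun i hi => hd fun h => ha (h ▸ hi)
  set R : Finset ℕ → Set X := fun s => ⋃ i : {i // i ∉ s}, A i with hRdef
  have hRm : ∀ s, MeasurableSet (R s) := fun s => MeasurableSet.iUnion fun i => (hA i).1
  have hR : ∀ s, IsRelCompactBorel (R s) := fun s =>
    hU.mono (hRm s) (Set.iUnion_subset fun i => Set.subset_iUnion A i)
  have hsplit : ∀ s, (⋃ i ∈ s, A i) ∪ R s = ⋃ i, A i := by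
    intro s
    ext x
    simp only [hRdef, Set.mem_union, Set.mem_iUnion, Subtype.exists]
    constructor
    · rintro (⟨i, -, h⟩ | ⟨i, -, h⟩) <;> exact ⟨i, h⟩
    · rintro ⟨i, h⟩
      by_cases hi : i ∈ s
      · exact Or.inl ⟨i, hi, h⟩
      · exact Or.inr ⟨i, hi, h⟩
  have hdisj : ∀ s, Disjoint (⋃ i ∈ s, A i) (R s) := by
    intro s
    rw [Set.disjoint_iUnion₂_left]
    intro i hi
    rw [Set.disjoint_iUnion_right]
    exact fun j => hd fun h => j.2 (h ▸ hi)
  have hζ : Tendsto (fun s => ζ (R s)) atTop (𝓝 0) := by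
    have h1 : ∑' i, ζ (A i) ≠ ∞ := by
      rw [← measure_iUnion (fun i j hij => hd hij) fun i => (hA i).1]
      exact hU.measure_ne_top ζ
    refine (ENNReal.tendsto_tsum_compl_atTop_zero h1).congr fun s => ?_
    rw [hRdef, measure_iUnion (fun i j hij => hd fun h => hij (Subtype.ext h)) fun i => (hA i).1]
  have hlim := (hcont R hR hζ).const_sub (v (⋃ i, A i))
  rw [sub_zero] at hlim
  refine hlim.congr fun s => ?_
  rw [← hfin, ← hsplit s, hadd _ _ (.biUnion_finset s hA) (hR s) (hdisj s)]
  ring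

variable {Ω : Type*} [MeasurableSpace Ω] {P : Measure Ω} [IsProbabilityMeasure P]
  [Fact (1 ≤ q)] {L : ℝ≥0 → Lp ℝ q ζ →ₗ[ℝ] (Ω →ₘ[P] ℝ)} {Ψ : Lp ℝ q ζ → ℂ}

/-- The symbol is additive over multiples of indicators of disjoint sets. -/
theorem IsIndependentlyScattered.symbol_sum (h : IsIndependentlyScattered P ζ q L)
    (hΨ : IsSymbol P ζ q L Ψ) {ι : Type*} [Fintype ι] {A : ι → Set X}
    (hA : ∀ i, IsRelCompactBorel (A i)) (hd : Pairwise fun i j => Disjoint (A i) (A j))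
    (u : ι → ℝ) :
    Ψ (∑ i, u i • indicatorLp ζ q (hA i)) = ∑ i, Ψ (u i • indicatorLp ζ q (hA i)) := by
  set e := (Fintype.equivFin ι).symm
  have h1 := (hΨ.iIndepFun_iff _).1 (h _ (fun k => A (e k)) (fun k => hA (e k))
    fun j k hjk => hd (e.injective.ne hjk)) fun k => u (e k)
  rwa [e.sum_comp fun i => u i • indicatorLp ζ q (hA i),
    e.sum_comp fun i => Ψ (u i • indicatorLp ζ q (hA i))] at h1

/-- The Khintchine measures and the drifts of all indicator functions. -/
structure IsKhintchineField (Ψ : Lp ℝ q ζ → ℂ) (M : Set X → Measure ℝ) (γ : Set X → ℝ) : Prop where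
  hasKhintchine : ∀ A (hA : IsRelCompactBorel A), HasKhintchine Ψ (indicatorLp ζ q hA) (M A) (γ A)
  add : ∀ A B, IsRelCompactBorel A → IsRelCompactBorel B → Disjoint A B →
    M (A ∪ B) = M A + M B ∧ γ (A ∪ B) = γ A + γ B

theorem IsIndependentlyScattered.exists_isKhintchineField (h : IsIndependentlyScattered P ζ q L)
    (hΨ : IsSymbol P ζ q L Ψ) (hc : Continuous Ψ) : ∃ M γ, IsKhintchineField Ψ M γ := by
  classical
  have h1 : ∀ A : Set X, ∃ M γ, ∀ hA : IsRelCompactBorel A,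
      HasKhintchine Ψ (indicatorLp ζ q hA) M γ := by
    intro A
    by_cases hA : IsRelCompactBorel A
    · obtain ⟨M, γ, hM⟩ := hΨ.exists_hasKhintchine hc (indicatorLp ζ q hA)
      exact ⟨M, γ, fun _ => hM⟩
    · exact ⟨0, 0, fun h => absurd h hA⟩
  choose M γ hMγ using h1
  refine ⟨M, γ, hMγ, fun A B hA hB hd => ?_⟩
  refine HasKhintchine.add hc (hMγ A hA) (hMγ B hB)
    (indicatorLp_union (ζ := ζ) (q := q) hA hB hd ▸ hMγ _ (hA.union hB)) fun u => ?_
  have := h.symbol_sum hΨ (A := fun b : Bool => if b then A else B)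
    (fun b => by cases b <;> simpa) (by
      intro a b hab
      cases a <;> cases b <;> simp_all [disjoint_comm]) fun _ => u
  simpa [Fintype.sum_bool, smul_add] using this

theorem IsKhintchineField.hasSum_drift [T2Space X] {M : Set X → Measure ℝ} {γ : Set X → ℝ}
    (h : IsKhintchineField Ψ M γ) (hq : q ≠ ∞) (hc : Continuous Ψ) (h0 : Ψ 0 = 0)
    {A : ℕ → Set X} (hA : ∀ i, IsRelCompactBorel (A i))
    (hd : Pairwise fun i j => Disjoint (A i) (A j)) (hU : IsRelCompactBorel (⋃ i, A i)) :
    HasSum (fun i => γ (A i)) (γ (⋃ i, A i)) :=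
  hasSum_of_additive (ζ := ζ) (fun A B hA hB hd => (h.add A B hA hB hd).2)
    (fun _ hR hζ => HasKhintchine.tendsto_drift hc h0 (fun s => h.hasKhintchine _ (hR s))
      (tendsto_indicatorLp_zero hq hR hζ)) hA hd hU

theorem IsKhintchineField.measure_iUnion [T2Space X] {M : Set X → Measure ℝ} {γ : Set X → ℝ}
    (h : IsKhintchineField Ψ M γ) (hq : q ≠ ∞) (hc : Continuous Ψ) (h0 : Ψ 0 = 0)
    {A : ℕ → Set X} (hA : ∀ i, IsRelCompactBorel (A i))
    (hd : Pairwise fun i j => Disjoint (A i) (A j)) (hU : IsRelCompactBorel (⋃ i, A i)) :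
    M (⋃ i, A i) = Measure.sum fun i => M (A i) := by
  have hfin : ∀ A, IsRelCompactBorel A → IsFiniteMeasure (M A) := fun A hA =>
    (h.hasKhintchine A hA).isFinite
  ext B hB
  have hsum : HasSum (fun i => (M (A i)).real B) ((M (⋃ i, A i)).real B) := by
    refine hasSum_of_additive (ζ := ζ) (v := fun A => (M A).real B) (fun A C hA hC hd => ?_)
      (fun R hR hζ => ?_) hA hd hU
    · have := hfin A hA
      have := hfin C hC
      rw [(h.add A C hA hC hd).1, measureReal_add_apply]
    · refine squeeze_zero (fun s => measureReal_nonneg) (fun s => ?_)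
        (HasKhintchine.tendsto_measure_univ hc h0 (fun s => h.hasKhintchine _ (hR s))
          (tendsto_indicatorLp_zero hq hR hζ))
      have := hfin _ (hR s)
      exact measureReal_mono (Set.subset_univ _)
  rw [Measure.sum_apply _ hB]
  have := hfin _ hU
  rw [← ofReal_measureReal (measure_ne_top _ _), ← hsum.tsum_eq,
    ENNReal.ofReal_tsum_of_nonneg (fun i => measureReal_nonneg) hsum.summable]
  refine tsum_congr fun i => ?_
  have := hfin _ (hA i)
  exact ofReal_measureReal (measure_ne_top _ _)

theorem IsKhintchineField.measure_eq_zero {M : Set X → Measure ℝ} {γ : Set X → ℝ}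
    (h : IsKhintchineField Ψ M γ) (hq : q ≠ ∞) (hc : Continuous Ψ) (h0 : Ψ 0 = 0) {A : Set X}
    (hA : IsRelCompactBorel A) (hζ : ζ A = 0) : M A = 0 ∧ γ A = 0 := by
  have h1 : indicatorLp ζ q hA = 0 :=
    tendsto_nhds_unique (tendsto_const_nhds (f := (⊤ : Filter ℕ)))
      (tendsto_indicatorLp_zero hq (fun _ => hA) (by simp [hζ]))
  have hf : Tendsto (fun _ : ℕ => indicatorLp ζ q hA) atTop (𝓝 0) := by simp [h1]
  have h2 := tendsto_nhds_unique tendsto_const_nhds (HasKhintchine.tendsto_measure_univ hc h0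
    (fun _ => h.hasKhintchine _ hA) hf)
  have h3 := tendsto_nhds_unique tendsto_const_nhds (HasKhintchine.tendsto_drift hc h0
    (fun _ => h.hasKhintchine _ hA) hf)
  have := (h.hasKhintchine _ hA).isFinite
  exact ⟨Measure.measure_univ_eq_zero.1 ((measureReal_eq_zero_iff).1 h2), h3⟩

end SetFunctions

end CylLevy

namespace CylLevy

/-! ### The characteristics -/

section Characteristics

theorem sectionMeasure_withDensity_snd {X : Type*} [MeasurableSpace X] (K : Measure (X × ℝ))
    {A : Set X} (hA : MeasurableSet A) {w : ℝ → ℝ≥0∞} (hw : Measurable w) :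
    sectionMeasure (K.withDensity fun z => w z.2) A = (sectionMeasure K A).withDensity w := by
  ext B hB
  rw [sectionMeasure_apply _ _ hB, withDensity_apply _ (hA.prod hB), withDensity_apply _ hB,
    sectionMeasure, ← lintegral_indicator hB, lintegral_map (hw.indicator hB) measurable_snd,
    ← lintegral_indicator (hA.prod hB), ← lintegral_indicator (hA.prod .univ)]
  refine lintegral_congr fun z => ?_
  by_cases h1 : z.1 ∈ A <;> by_cases h2 : z.2 ∈ B <;> simp [Set.indicator, h1, h2]

variable {X : Type*} [TopologicalSpace X] [T2Space X] [MeasurableSpace X]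
  {ζ : Measure X} [IsLocallyFiniteMeasure ζ] {q : ℝ≥0∞} [Fact (1 ≤ q)] {Ψ : Lp ℝ q ζ → ℂ}
  {M : Set X → Measure ℝ} {γ : Set X → ℝ}

/-- The Khintchine measures of the indicator functions are the sections of a measure. -/
theorem IsKhintchineField.exists_measure_prod (h : IsKhintchineField Ψ M γ) (hq : q ≠ ∞)
    (hc : Continuous Ψ) (h0 : Ψ 0 = 0) {D : ℕ → Set X} (hD : ∀ n, IsRelCompactBorel (D n))
    (hDd : Pairwise fun i j => Disjoint (D i) (D j)) (hDζ : ζ (⋃ n, D n)ᶜ = 0) :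
    ∃ K : Measure (X × ℝ), SigmaFinite K ∧ (∀ A, IsRelCompactBorel A → sectionMeasure K A = M A) ∧
      K ((⋃ n, D n)ᶜ ×ˢ Set.univ) = 0 := by
  have hDm : MeasurableSet (⋃ n, D n) := MeasurableSet.iUnion fun n => (hD n).1
  have hM0 : M ∅ = 0 := (h.measure_eq_zero hq hc h0 .empty measure_empty).1
  set m : Set X → Measure ℝ := fun A => Measure.sum fun n => M (A ∩ D n) with hm
  have hAD : ∀ A, MeasurableSet A → ∀ n, IsRelCompactBorel (A ∩ D n) := fun A hA n =>
    (hD n).mono (hA.inter (hD n).1) Set.inter_subset_right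
  have hmM : ∀ A, IsRelCompactBorel A → m A = M A := by
    intro A hA
    have hA1 : IsRelCompactBorel (⋃ n, A ∩ D n) := by
      rw [← Set.inter_iUnion]
      exact hA.inter_left hDm
    have hA2 : IsRelCompactBorel (A \ ⋃ n, D n) := hA.mono (hA.1.diff hDm) Set.sdiff_subset
    have h1 : m A = M (⋃ n, A ∩ D n) := (h.measure_iUnion hq hc h0 (hAD A hA.1)
      (fun i j hij => (hDd hij).mono Set.inter_subset_right Set.inter_subset_right) hA1).symm
    have h2 := (h.add _ _ hA1 hA2 (by
      rw [← Set.inter_iUnion]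
      exact Set.disjoint_sdiff_right.mono_left Set.inter_subset_right)).1
    rw [(h.measure_eq_zero hq hc h0 hA2 (measure_mono_null (Set.sdiff_subset_compl _ _) hDζ)).1,
      add_zero, ← Set.inter_iUnion, Set.inter_union_sdiff, Set.inter_iUnion] at h2
    rw [h1, h2]
  have hmN : m (⋃ n, D n)ᶜ = 0 := by
    have : ∀ n, (⋃ n, D n)ᶜ ∩ D n = ∅ := fun n =>
      (disjoint_compl_left.mono_right (Set.subset_iUnion D n)).inter_eq
    simp only [hm, this, hM0]
    exact Measure.sum_zero
  have hNfin : m (⋃ n, D n)ᶜ Set.univ < ∞ := by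
    rw [hmN]
    simp
  have hfin : ∀ A, IsRelCompactBorel A → m A Set.univ < ∞ := by
    intro A hA
    rw [hmM A hA]
    have := (h.hasKhintchine A hA).isFinite
    exact measure_lt_top _ _
  obtain ⟨K, hK, hKm⟩ := exists_measure_prod_of_bimeasure m (by simp [hm, hM0])
    (fun A hA hd => by
      simp only [hm]
      rw [Measure.sum_comm]
      congr 1
      ext1 n
      rw [Set.iUnion_inter]
      refine h.measure_iUnion hq hc h0 (fun i => hAD _ (hA i) n)
        (fun i j hij => (hd hij).mono Set.inter_subset_left Set.inter_subset_left) ?_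
      rw [← Set.iUnion_inter]
      exact hAD _ (MeasurableSet.iUnion hA) n)
    (fun n => Nat.casesOn n (⋃ n, D n)ᶜ D)
    (fun n => by cases n; exacts [hDm.compl, (hD _).1])
    (fun n => by cases n; exacts [hNfin, hfin _ (hD _)])
    (by
      refine Set.eq_univ_of_forall fun x => ?_
      by_cases hx : x ∈ ⋃ n, D n
      · obtain ⟨n, hn⟩ := Set.mem_iUnion.1 hx
        exact Set.mem_iUnion.2 ⟨n + 1, hn⟩
      · exact Set.mem_iUnion.2 ⟨0, hx⟩)
  refine ⟨K, hK, fun A hA => ?_, ?_⟩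
  · rw [hKm A hA.1 (hfin A hA), hmM A hA]
  · rw [← sectionMeasure_apply _ _ MeasurableSet.univ, hKm _ hDm.compl hNfin, hmN]
    rfl

/-- The density of a Lévy measure with respect to its Khintchine measure. -/
noncomputable def invWeight (y : ℝ) : ℝ≥0∞ := ENNReal.ofReal (weight y)⁻¹

theorem measurable_invWeight : Measurable invWeight :=
  continuous_weight.measurable.inv.ennreal_ofReal

theorem isLevyMeasure_withDensity_invWeight (N : Measure ℝ) [IsFiniteMeasure N] :
    IsLevyMeasure (N.withDensity invWeight) := by
  constructor
  · rw [withDensity_apply _ (measurableSet_singleton 0), lintegral_singleton]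
    simp [invWeight, weight_zero]
  · rw [lintegral_withDensity_eq_lintegral_mul _ measurable_invWeight (by fun_prop)]
    refine lt_of_le_of_lt (lintegral_mono (g := fun _ => ENNReal.ofReal (384 / 11)) fun y => ?_) ?_
    · rw [Pi.mul_apply, invWeight, ← ENNReal.ofReal_mul (inv_nonneg.2 (weight_nonneg y))]
      refine ENNReal.ofReal_le_ofReal ?_
      by_cases hy : y = 0
      · norm_num [hy]
      · rw [inv_mul_le_iff₀ (weight_pos hy)]
        linarith [le_weight y]
    · rw [lintegral_const]
      exact ENNReal.mul_lt_top ENNReal.ofReal_lt_top (measure_lt_top _ _)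

/-- The difference of the truncation functions `y 1_{|y| ≤ 1}` and `sin y`. -/
noncomputable def truncDiff (y : ℝ) : ℝ := y * Set.indicator (Set.Icc (-1 : ℝ) 1) 1 y - Real.sin y

theorem measurable_truncDiff : Measurable truncDiff := by
  have h : Measurable (Set.indicator (Set.Icc (-1 : ℝ) 1) (1 : ℝ → ℝ)) :=
    measurable_one.indicator measurableSet_Icc
  unfold truncDiff
  fun_prop

theorem abs_truncDiff_le (y : ℝ) : |truncDiff y| ≤ 3 * min 1 (y ^ 2) := by
  by_cases h : y ∈ Set.Icc (-1 : ℝ) 1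
  · have h2 : y ^ 2 ≤ 1 := by nlinarith [h.1, h.2]
    rw [truncDiff, Set.indicator_of_mem h, Pi.one_apply, mul_one, min_eq_right h2]
    exact abs_self_sub_sin_le y
  · have h2 : 1 ≤ y ^ 2 := by
      by_contra! hlt
      exact h (abs_le.1 (abs_le_one_iff_mul_self_le_one.2 (by nlinarith)))
    rw [truncDiff, Set.indicator_of_notMem h, min_eq_left h2, mul_zero, zero_sub, abs_neg]
    linarith [Real.abs_sin_le_one y]

theorem IsLevyMeasure.integrable_min {μ : Measure ℝ} (h : IsLevyMeasure μ) :
    Integrable (fun y => min 1 (y ^ 2)) μ := by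
  refine ⟨Measurable.aestronglyMeasurable (by fun_prop), ?_⟩
  refine lt_of_eq_of_lt (lintegral_congr fun y => ?_) h.2
  rw [Real.enorm_of_nonneg (by positivity)]

/-- The integrand of the jump part in terms of `u = f x`. -/
noncomputable def jumpFun (u y : ℝ) : ℂ := jumpIntegrand (fun _ : Unit => u) ((), y)

theorem jumpFun_eq (u y : ℝ) :
    jumpFun u y = sinIntegrand u y - Complex.I * ((u * truncDiff y : ℝ) : ℂ) := by
  simp only [jumpFun, jumpIntegrand, sinIntegrand, truncDiff]
  push_cast
  ring

theorem integral_kernel_eq (N : Measure ℝ) [IsFiniteMeasure N] (u : ℝ) :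
    ∫ y, kernel u y ∂N = -3 * (u : ℂ) ^ 2 * N.real {0} +
      (Complex.I * ((u * ∫ y, truncDiff y ∂(N.withDensity invWeight) : ℝ) : ℂ)
        + ∫ y, jumpFun u y ∂(N.withDensity invWeight)) := by
  have hL := isLevyMeasure_withDensity_invWeight N
  have hi1 : Integrable truncDiff (N.withDensity invWeight) :=
    (hL.integrable_min.const_mul 3).mono' measurable_truncDiff.aestronglyMeasurable
      (Eventually.of_forall abs_truncDiff_le)
  have hi2 : Integrable (sinIntegrand u) (N.withDensity invWeight) :=
    (hL.integrable_min.const_mul _).mono' (continuous_sinIntegrand u).aestronglyMeasurable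
      (Eventually.of_forall (norm_sinIntegrand_le u))
  have h1 : ∫ y, sinIntegrand u y ∂(N.withDensity invWeight) =
      Complex.I * ((u * ∫ y, truncDiff y ∂(N.withDensity invWeight) : ℝ) : ℂ)
        + ∫ y, jumpFun u y ∂(N.withDensity invWeight) := by
    have hi5 : Integrable (fun y => Complex.I * ((u * truncDiff y : ℝ) : ℂ))
        (N.withDensity invWeight) := ((hi1.const_mul u).ofReal (𝕜 := ℂ)).const_mul _
    simp only [jumpFun_eq]
    rw [integral_sub hi2 hi5, integral_const_mul, integral_complex_ofReal, integral_const_mul]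
    push_cast
    ring
  rw [← h1, integral_withDensity_eq_integral_toReal_smul measurable_invWeight
    (Eventually.of_forall fun y => ENNReal.ofReal_lt_top)]
  have h2 : ∀ y, kernel u y = ({0} : Set ℝ).indicator (fun _ => -3 * (u : ℂ) ^ 2) y
      + (invWeight y).toReal • sinIntegrand u y := by
    intro y
    rw [invWeight, ENNReal.toReal_ofReal (inv_nonneg.2 (weight_nonneg y))]
    by_cases hy : y = 0
    · simp [hy, kernel]
    · rw [Set.indicator_of_notMem (by simpa using hy), zero_add, kernel, if_neg hy,
        Complex.real_smul, Complex.ofReal_inv, div_eq_inv_mul]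
  have hi3 : Integrable (({0} : Set ℝ).indicator (fun _ => -3 * (u : ℂ) ^ 2)) N :=
    (integrable_const _).indicator (measurableSet_singleton 0)
  have hi4 : Integrable (fun y => (invWeight y).toReal • sinIntegrand u y) N := by
    refine ((integrable_kernel N u).sub hi3).congr (Eventually.of_forall fun y => ?_)
    simp [h2 y]
  rw [integral_congr_ae (Eventually.of_forall h2), integral_add hi3 hi4,
    integral_indicator_const _ (measurableSet_singleton 0), Complex.real_smul]
  ring

end Characteristics

end CylLevy

namespace CylLevy

section CharacteristicsOfField

theorem integral_sectionMeasure {X E : Type*} [MeasurableSpace X] [NormedAddCommGroup E]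
    [NormedSpace ℝ E] [MeasurableSpace E] [BorelSpace E] [SecondCountableTopology E]
    (ν : Measure (X × ℝ)) (A : Set X) {φ : ℝ → E} (hφ : Measurable φ) :
    ∫ y, φ y ∂(sectionMeasure ν A) = ∫ z in A ×ˢ Set.univ, φ z.2 ∂ν := by
  rw [sectionMeasure, integral_map measurable_snd.aemeasurable hφ.aestronglyMeasurable]

theorem measurable_jumpFun (u : ℝ) : Measurable (jumpFun u) :=
  (measurable_jumpIntegrand (f := fun _ : Unit => u) measurable_const).comp (by fun_prop)

variable {X : Type*} [TopologicalSpace X] [T2Space X] [MeasurableSpace X]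
  {ζ : Measure X} [IsLocallyFiniteMeasure ζ] {q : ℝ≥0∞} [Fact (1 ≤ q)] {Ψ : Lp ℝ q ζ → ℂ}
  {M : Set X → Measure ℝ} {γ : Set X → ℝ}

/-- On multiples of indicator functions, `Ψ` is given by characteristics. -/
structure HasIndicatorForm (ζ : Measure X) [IsLocallyFiniteMeasure ζ] (Ψ : Lp ℝ q ζ → ℂ)
    (c : Characteristics X) : Prop where
  apply_smul : ∀ A (hA : IsRelCompactBorel A) (u : ℝ), Ψ (u • indicatorLp ζ q hA) =
    Complex.I * ((u * c.γ.toFun A : ℝ) : ℂ) + ∫ z in A ×ˢ Set.univ, jumpFun u z.2 ∂c.ν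
      - 1 / 2 * ((u ^ 2 * c.gaussian.real A : ℝ) : ℂ)

theorem IsKhintchineField.exists_characteristics (h : IsKhintchineField Ψ M γ) (hq : q ≠ ∞)
    (hc : Continuous Ψ) (h0 : Ψ 0 = 0) {D : ℕ → Set X} (hD : ∀ n, IsRelCompactBorel (D n))
    (hDd : Pairwise fun i j => Disjoint (D i) (D j)) (hDζ : ζ (⋃ n, D n)ᶜ = 0) :
    ∃ c : Characteristics X, c.gaussian (⋃ n, D n)ᶜ = 0 ∧ HasIndicatorForm ζ Ψ c := by
  classical
  obtain ⟨K, hK, hKM, hKN⟩ := h.exists_measure_prod hq hc h0 hD hDd hDζ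
  have hfin : ∀ A, IsRelCompactBorel A → IsFiniteMeasure (M A) := fun A hA =>
    (h.hasKhintchine A hA).isFinite
  set ν : Measure (X × ℝ) := K.withDensity fun z => invWeight z.2 with hν
  have hνA : ∀ A, IsRelCompactBorel A → sectionMeasure ν A = (M A).withDensity invWeight := by
    intro A hA
    rw [hν, sectionMeasure_withDensity_snd K hA.1 measurable_invWeight, hKM A hA]
  have hL : ∀ A, IsRelCompactBorel A → IsLevyMeasure (sectionMeasure ν A) := by
    intro A hA
    rw [hνA A hA]
    have := hfin A hA
    exact isLevyMeasure_withDensity_invWeight _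
  have hσ : SigmaFinite ν := by
    have : SigmaFinite (K.withDensity fun z => ((weight z.2)⁻¹.toNNReal : ℝ≥0∞)) :=
      SigmaFinite.withDensity _
    exact this
  set G : Measure X := (6 : ℝ≥0∞) • (K.restrict (Set.univ ×ˢ {0})).map Prod.fst with hG
  have hGA : ∀ A, MeasurableSet A → G A = 6 * K (A ×ˢ {0}) := by
    intro A hA
    rw [hG, Measure.smul_apply, smul_eq_mul, Measure.map_apply measurable_fst hA,
      Measure.restrict_apply (measurable_fst hA)]
    congr 2
    ext z
    simp
  have hGM : ∀ A, IsRelCompactBorel A → G A = 6 * M A {0} := by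
    intro A hA
    rw [hGA A hA.1, ← sectionMeasure_apply K A (measurableSet_singleton 0), hKM A hA]
  have hint : ∀ A, IsRelCompactBorel A →
      IntegrableOn (fun z : X × ℝ => truncDiff z.2) (A ×ˢ Set.univ) ν := by
    intro A hA
    have h1 : Integrable truncDiff (sectionMeasure ν A) :=
      ((hL A hA).integrable_min.const_mul 3).mono' measurable_truncDiff.aestronglyMeasurable
        (Eventually.of_forall abs_truncDiff_le)
    exact h1.comp_measurable measurable_snd
  set v : Set X → ℝ := fun A => γ A + ∫ z in A ×ˢ Set.univ, truncDiff z.2 ∂ν with hv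
  let c : Characteristics X :=
    { γ :=
      { toFun := v
        empty := by simp [hv, (h.measure_eq_zero hq hc h0 .empty measure_empty).2]
        hasSum_iUnion := fun A hA hd hU => by
          refine (h.hasSum_drift hq hc h0 hA hd hU).add ?_
          rw [Set.iUnion_prod_const]
          refine hasSum_integral_iUnion (fun i => (hA i).1.prod .univ)
            (fun i j hij => Set.disjoint_prod.2 (Or.inl (hd hij))) ?_
          rw [← Set.iUnion_prod_const]
          exact hint _ hU }
      gaussian := G
      gaussian_lt_top := fun A hA => by
        have := hfin A hA
        rw [hGM A hA]
        exact ENNReal.mul_lt_top (by simp) (measure_lt_top _ _)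
      ν := ν
      sigmaFinite := hσ
      isLevyMeasure := hL }
  refine ⟨c, ?_, ⟨fun A hA u => ?_⟩⟩
  · change G _ = 0
    rw [hGA _ (MeasurableSet.iUnion fun n => (hD n).1).compl,
      measure_mono_null (Set.prod_mono le_rfl (Set.subset_univ _)) hKN, mul_zero]
  · have := hfin A hA
    change _ = Complex.I * ((u * v A : ℝ) : ℂ) + ∫ z in A ×ˢ Set.univ, jumpFun u z.2 ∂ν
      - 1 / 2 * ((u ^ 2 * G.real A : ℝ) : ℂ)
    have hGr : G.real A = 6 * (M A).real {0} := by
      rw [Measure.real, hGM A hA, ENNReal.toReal_mul]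
      rfl
    have hvA : v A = γ A + ∫ z in A ×ˢ Set.univ, truncDiff z.2 ∂ν := rfl
    rw [(h.hasKhintchine A hA).apply_eq u, integral_kernel_eq, hGr, hvA,
      ← integral_sectionMeasure ν A measurable_truncDiff,
      ← integral_sectionMeasure ν A (measurable_jumpFun u), hνA A hA]
    push_cast
    ring

end CharacteristicsOfField

end CylLevy

namespace CylLevy

/-! ### The symbol on bounded functions -/

theorem tendsto_eLpNorm_sub_of_dominated {X : Type*} [MeasurableSpace X] {ζ : Measure X}
    {q : ℝ≥0∞} (hq0 : q ≠ 0) (hq : q ≠ ∞) {F : ℕ → X → ℝ} {f g : X → ℝ}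
    (hF : ∀ n, Measurable (F n)) (hf : Measurable f) (hg : MemLp g q ζ)
    (hb : ∀ n x, |F n x - f x| ≤ g x) (hlim : ∀ᵐ x ∂ζ, Tendsto (fun n => F n x) atTop (𝓝 (f x))) :
    Tendsto (fun n => eLpNorm (F n - f) q ζ) atTop (𝓝 0) := by
  have hq' : 0 < q.toReal := ENNReal.toReal_pos hq0 hq
  simp only [eLpNorm_eq_lintegral_rpow_enorm_toReal hq0 hq]
  have h1 : Tendsto (fun n => ∫⁻ x, ‖(F n - f) x‖ₑ ^ q.toReal ∂ζ) atTop
      (𝓝 (∫⁻ _, 0 ∂ζ)) := by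
    refine tendsto_lintegral_of_dominated_convergence (fun x => ‖g x‖ₑ ^ q.toReal)
      (fun n => (((hF n).sub hf).enorm).pow_const _)
      (fun n => Eventually.of_forall fun x => ?_)
      (lintegral_rpow_enorm_lt_top_of_eLpNorm_lt_top hq0 hq hg.2).ne
      (hlim.mono fun x hx => ?_)
    · refine ENNReal.rpow_le_rpow ?_ hq'.le
      refine enorm_le_iff_norm_le.2 ?_
      exact (hb n x).trans (le_abs_self _)
    · have h2 : Tendsto (fun n => ‖(F n - f) x‖ₑ) atTop (𝓝 0) := by
        have := (hx.sub_const (f x)).enorm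
        simpa using this
      have h3 := (ENNReal.continuous_rpow_const (y := q.toReal)).tendsto 0 |>.comp h2
      rwa [ENNReal.zero_rpow_of_pos hq'] at h3
  rw [lintegral_zero] at h1
  have h4 := (ENNReal.continuous_rpow_const (y := 1 / q.toReal)).tendsto 0 |>.comp h1
  rwa [ENNReal.zero_rpow_of_pos (by positivity)] at h4

section Bounded

variable {X : Type*} [TopologicalSpace X] [MeasurableSpace X]
  {ζ : Measure X} [IsLocallyFiniteMeasure ζ] {q : ℝ≥0∞}

theorem memLp_indicator_of_bounded {A : Set X} (hA : IsRelCompactBorel A) {f : X → ℝ}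
    (hf : Measurable f) {C : ℝ} (hC : ∀ x ∈ A, |f x| ≤ C) : MemLp (A.indicator f) q ζ := by
  refine MemLp.mono (g := A.indicator fun _ => C)
    (memLp_indicator_const q hA.1 C (Or.inr (hA.measure_ne_top ζ)))
    (hf.indicator hA.1).aestronglyMeasurable (Eventually.of_forall fun x => ?_)
  by_cases hx : x ∈ A
  · simpa [hx] using (hC x hx).trans (le_abs_self C)
  · simp [hx]

theorem Characteristics.integrableOn_sq (c : Characteristics X) {A : Set X}
    (hA : IsRelCompactBorel A) {f : X → ℝ} (hf : Measurable f) {C : ℝ}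
    (hC : ∀ x ∈ A, |f x| ≤ C) : IntegrableOn (fun x => f x ^ 2) A c.gaussian := by
  have : IsFiniteMeasure (c.gaussian.restrict A) := ⟨by
    rw [Measure.restrict_apply_univ]
    exact c.gaussian_lt_top A hA⟩
  refine Integrable.of_bound (C := C ^ 2) (hf.pow_const 2).aestronglyMeasurable ?_
  filter_upwards [ae_restrict_mem hA.1] with x hx
  rw [norm_pow]
  exact pow_le_pow_left₀ (abs_nonneg _) (hC x hx) 2

variable [T2Space X] {Ψ : Lp ℝ q ζ → ℂ} {c : Characteristics X}

theorem HasIndicatorForm.apply_indicator (h : HasIndicatorForm ζ Ψ c) {A B : Set X}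
    (hA : IsRelCompactBorel A) (hB : MeasurableSet B) (u : ℝ) :
    Ψ (u • indicatorLp ζ q (hA.inter_left hB)) = c.localForm hA (B.indicator fun _ => u)
      - 1 / 2 * ((∫ x in A, (B.indicator (fun _ => u) x) ^ 2 ∂c.gaussian : ℝ) : ℂ) := by
  rw [h.apply_smul, Characteristics.localForm, c.γ.setIntegral_indicator hA hB]
  congr 2
  · have h1 : ∀ z : X × ℝ, jumpIntegrand (B.indicator fun _ => u) z =
        (B ×ˢ Set.univ).indicator (fun z : X × ℝ => jumpFun u z.2) z := by
      intro z
      by_cases hz : z.1 ∈ B <;> simp [Set.indicator, hz, jumpFun, jumpIntegrand]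
    simp only [h1]
    rw [setIntegral_indicator (hB.prod .univ), Set.prod_inter_prod, Set.univ_inter]
  · congr 1
    have h1 : ∀ x, (B.indicator (fun _ => u) x) ^ 2 = B.indicator (fun _ => u ^ 2) x := by
      intro x
      by_cases hx : x ∈ B <;> simp [hx]
    simp only [h1]
    rw [setIntegral_indicator hB, setIntegral_const, smul_eq_mul, mul_comm]

variable [Fact (1 ≤ q)] {Ω : Type*} [MeasurableSpace Ω] {P : Measure Ω} [IsProbabilityMeasure P]
  {L : ℝ≥0 → Lp ℝ q ζ →ₗ[ℝ] (Ω →ₘ[P] ℝ)}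

theorem HasIndicatorForm.apply_simpleFunc (h : HasIndicatorForm ζ Ψ c)
    (hs : IsIndependentlyScattered P ζ q L) (hΨ : IsSymbol P ζ q L Ψ) {A : Set X}
    (hA : IsRelCompactBorel A) (f : SimpleFunc X ℝ) (hf : MemLp (A.indicator f) q ζ) :
    Ψ (hf.toLp _) = c.localForm hA f
      - 1 / 2 * ((∫ x in A, f x ^ 2 ∂c.gaussian : ℝ) : ℂ) := by
  classical
  set B : f.range → Set X := fun y => f ⁻¹' {(y : ℝ)} with hB
  have hBm : ∀ y, MeasurableSet (B y) := fun y => f.measurableSet_preimage _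
  set b : f.range → X → ℝ := fun y => (B y).indicator fun _ => (y : ℝ) with hb
  have hfsum : ∀ x, f x = ∑ y, b y x := by
    intro x
    rw [Finset.sum_eq_single (⟨f x, f.mem_range_self x⟩ : f.range)]
    · simp [hb, hB]
    · intro y _ hy
      refine Set.indicator_of_notMem (fun hx => hy ?_) _
      exact Subtype.ext (Set.mem_singleton_iff.1 hx).symm
    · simp
  have hbm : ∀ y, Measurable (b y) := fun y => measurable_const.indicator (hBm y)
  have hbC : ∀ y, ∃ C, ∀ x ∈ A, |b y x| ≤ C := fun y => ⟨|(y : ℝ)|, fun x _ => by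
    by_cases hx : x ∈ B y <;> simp [hb, hx]⟩
  have hdisj : ∀ x (y z : f.range), y ≠ z → b y x = 0 ∨ b z x = 0 := by
    intro x y z hyz
    by_cases hx : x ∈ B y
    · refine Or.inr (Set.indicator_of_notMem (fun hx' => hyz (Subtype.ext ?_)) _)
      exact (Set.mem_singleton_iff.1 hx).symm.trans (Set.mem_singleton_iff.1 hx')
    · exact Or.inl (Set.indicator_of_notMem hx _)
  have hR : ∀ y, IsRelCompactBorel (A ∩ B y) := fun y => hA.inter_left (hBm y)
  have hmem : ∀ y : f.range, MemLp ((A ∩ B y).indicator fun _ => (y : ℝ)) q ζ := fun y =>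
    memLp_indicator_const q (hR y).1 _ (Or.inr ((hR y).measure_ne_top ζ))
  have hLp : hf.toLp _ = ∑ y : f.range, (y : ℝ) • indicatorLp ζ q (hR y) := by
    simp only [smul_indicatorLp (hR _) _ (hmem _)]
    rw [← MemLp.toLp_finset_sum Finset.univ hmem (memLp_finsetSum _ fun y _ => hmem y)]
    refine (MemLp.toLp_eq_toLp_iff _ _).2 (Eventually.of_forall fun x => ?_)
    by_cases hx : x ∈ A
    · rw [Set.indicator_of_mem hx, hfsum x]
      refine Finset.sum_congr rfl fun y _ => ?_
      by_cases hy : x ∈ B y <;> simp [hb, hx, hy]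
    · simp [hx]
  have hsq : ∫ x in A, f x ^ 2 ∂c.gaussian = ∑ y, ∫ x in A, b y x ^ 2 ∂c.gaussian := by
    rw [← integral_finsetSum _ fun y _ => c.integrableOn_sq hA (hbm y) (hbC y).choose_spec]
    refine integral_congr_ae (Eventually.of_forall fun x => ?_)
    simp only [hfsum x]
    by_cases hx : ∃ y, b y x ≠ 0
    · obtain ⟨y, hy⟩ := hx
      have h0 : ∀ z, z ≠ y → b z x = 0 := fun z hz => (hdisj x z y hz).resolve_right hy
      rw [Finset.sum_eq_single y (fun z _ hz => h0 z hz) (by simp),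
        Finset.sum_eq_single y (fun z _ hz => by rw [h0 z hz]; simp) (by simp)]
    · push Not at hx
      simp [hx]
  have hform : c.localForm hA f = ∑ y, c.localForm hA (b y) := by
    rw [← c.localForm_sum hA Finset.univ hbm hbC fun x y _ z _ hyz => hdisj x y z hyz]
    exact congrArg _ (funext hfsum)
  rw [hLp, hs.symbol_sum hΨ hR (fun y z hyz => ?_) fun y => (y : ℝ), hsq, hform,
    Complex.ofReal_sum, Finset.mul_sum, ← Finset.sum_sub_distrib]
  · exact Finset.sum_congr rfl fun y _ => h.apply_indicator hA (hBm y) y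
  · refine Disjoint.mono Set.inter_subset_right Set.inter_subset_right ?_
    refine Disjoint.preimage f ?_
    simpa using fun h => hyz (Subtype.ext h)

theorem HasIndicatorForm.apply_bounded (h : HasIndicatorForm ζ Ψ c) (hq : q ≠ ∞)
    (hc : Continuous Ψ) (hs : IsIndependentlyScattered P ζ q L) (hΨ : IsSymbol P ζ q L Ψ)
    {A : Set X} (hA : IsRelCompactBorel A) {f : X → ℝ} (hfm : Measurable f) {C : ℝ}
    (hC : ∀ x ∈ A, |f x| ≤ C) (hf : MemLp (A.indicator f) q ζ) :
    Ψ (hf.toLp _) = c.localForm hA f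
      - 1 / 2 * ((∫ x in A, f x ^ 2 ∂c.gaussian : ℝ) : ℂ) := by
  wlog hC0 : 0 ≤ C generalizing C
  · exact this (fun x hx => (hC x hx).trans (le_abs_self C)) (abs_nonneg C)
  have hsm := hfm.stronglyMeasurable
  set F : ℕ → SimpleFunc X ℝ := hsm.approxBounded C with hFdef
  have hFC : ∀ n x, |F n x| ≤ C := fun n x => hsm.norm_approxBounded_le hC0 n x
  have hFlim : ∀ x ∈ A, Tendsto (fun n => F n x) atTop (𝓝 (f x)) := fun x hx =>
    hsm.tendsto_approxBounded_of_norm_le (hC x hx)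
  have hFLp : ∀ n, MemLp (A.indicator (F n)) q ζ := fun n =>
    memLp_indicator_of_bounded hA (F n).measurable fun x _ => hFC n x
  have h1 : Tendsto (fun n => Ψ ((hFLp n).toLp _)) atTop (𝓝 (Ψ (hf.toLp _))) := by
    refine (hc.tendsto _).comp ((Lp.tendsto_Lp_iff_tendsto_eLpNorm'' _ hFLp _ hf).2 ?_)
    refine tendsto_eLpNorm_sub_of_dominated (g := A.indicator fun _ => 2 * C)
      (one_pos.trans_le (Fact.out : 1 ≤ q)).ne' hq (fun n => (F n).measurable.indicator hA.1)
      (hfm.indicator hA.1)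
      (memLp_indicator_const q hA.1 _ (Or.inr (hA.measure_ne_top ζ))) (fun n x => ?_)
      (Eventually.of_forall fun x => ?_)
    · by_cases hx : x ∈ A
      · simp only [Set.indicator_of_mem hx]
        have := (abs_sub _ _).trans (add_le_add (hFC n x) (hC x hx))
        linarith
      · simp [hx]
    · by_cases hx : x ∈ A
      · simpa [hx] using hFlim x hx
      · simp [hx]
  have h2 : Tendsto (fun n => c.γ.setIntegral hA (F n)) atTop (𝓝 (c.γ.setIntegral hA f)) := by
    refine VectorMeasure.tendsto_integral_of_dominated_convergence (fun _ => C)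
      (fun n => (F n).measurable.aestronglyMeasurable) (integrable_const C)
      (fun n => Eventually.of_forall fun x => hFC n x) ?_
    filter_upwards [c.γ.ae_mem_variation hA] with x hx using hFlim x hx
  have h3 : Tendsto (fun n => ∫ z in A ×ˢ Set.univ, jumpIntegrand (F n) z ∂c.ν) atTop
      (𝓝 (∫ z in A ×ˢ Set.univ, jumpIntegrand f z ∂c.ν)) := by
    refine tendsto_integral_of_dominated_convergence
      (fun z => (3 * C ^ 2 + 2) * min 1 (z.2 ^ 2))
      (fun n => (measurable_jumpIntegrand (F n).measurable).aestronglyMeasurable)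
      ((c.integrableOn_min hA).const_mul _) (fun n => Eventually.of_forall fun z => ?_) ?_
    · refine (norm_jumpIntegrand_le _ z).trans ?_
      have : F n z.1 ^ 2 ≤ C ^ 2 := by
        rw [← sq_abs]
        exact pow_le_pow_left₀ (abs_nonneg _) (hFC n z.1) 2
      gcongr
    · filter_upwards [ae_restrict_mem (hA.1.prod .univ)] with z hz
      have hcont : Continuous fun u => jumpFun u z.2 := by
        simp only [jumpFun, jumpIntegrand]
        fun_prop
      exact (hcont.tendsto (f z.1)).comp (hFlim z.1 hz.1)
  have h4 : Tendsto (fun n => ∫ x in A, F n x ^ 2 ∂c.gaussian) atTop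
      (𝓝 (∫ x in A, f x ^ 2 ∂c.gaussian)) := by
    have : IsFiniteMeasure (c.gaussian.restrict A) := ⟨by
      rw [Measure.restrict_apply_univ]
      exact c.gaussian_lt_top A hA⟩
    refine tendsto_integral_of_dominated_convergence (fun _ => C ^ 2)
      (fun n => ((F n).measurable.pow_const 2).aestronglyMeasurable) (integrable_const _)
      (fun n => Eventually.of_forall fun x => ?_) ?_
    · rw [norm_pow]
      exact pow_le_pow_left₀ (abs_nonneg _) (hFC n x) 2
    · filter_upwards [ae_restrict_mem hA.1] with x hx using (hFlim x hx).pow 2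
  refine tendsto_nhds_unique h1 ?_
  simp only [h.apply_simpleFunc hs hΨ hA]
  refine Tendsto.sub (Tendsto.add ?_ h3) ?_
  · exact ((Complex.continuous_ofReal.tendsto _).comp h2).const_mul _
  · exact ((Complex.continuous_ofReal.tendsto _).comp h4).const_mul _

end Bounded

end CylLevy

namespace CylLevy

/-! ### The symbol on `L^q` -/

section General

variable {X : Type*} [TopologicalSpace X] [T2Space X] [MeasurableSpace X]
  {ζ : Measure X} {q : ℝ≥0∞}

theorem Characteristics.re_localForm_nonpos (c : Characteristics X) {A : Set X}
    (hA : IsRelCompactBorel A) {f : X → ℝ} (hf : Measurable f) {C : ℝ}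
    (hC : ∀ x ∈ A, |f x| ≤ C) : (c.localForm hA f).re ≤ 0 := by
  have h1 : (∫ z in A ×ˢ Set.univ, jumpIntegrand f z ∂c.ν).re =
      ∫ z in A ×ˢ Set.univ, (jumpIntegrand f z).re ∂c.ν :=
    (Complex.reCLM.integral_comp_comm (c.integrableOn_jumpIntegrand hA hf hC)).symm
  have h2 : ∀ z, (jumpIntegrand f z).re ≤ 0 := by
    intro z
    have : (jumpIntegrand f z).re = Real.cos (f z.1 * z.2) - 1 := by
      rw [jumpIntegrand, mul_comm Complex.I, Complex.sub_re, Complex.sub_re,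
        Complex.exp_ofReal_mul_I_re, Complex.re_mul_ofReal]
      simp
    rw [this]
    linarith [Real.cos_le_one (f z.1 * z.2)]
  rw [Characteristics.localForm, Complex.add_re, h1, Complex.re_mul_ofReal, Complex.I_re, zero_mul,
    zero_add]
  exact integral_nonpos h2

/-- An exhausting sequence of relatively compact sets on which `f` is bounded. -/
def bddExhaustion {D : ℕ → Set X} (hD : ∀ n, IsRelCompactBorel (D n)) {f : X → ℝ}
    (hf : Measurable f) (k : ℕ) : BddSets f :=
  ⟨(⋃ n ∈ Finset.range k, D n) ∩ {x | |f x| ≤ k},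
    (IsRelCompactBorel.biUnion_finset _ hD).inter_left (measurableSet_le hf.abs measurable_const),
    k, fun _ hx => hx.2⟩

theorem eventually_mem_bddExhaustion {D : ℕ → Set X} (hD : ∀ n, IsRelCompactBorel (D n))
    {f : X → ℝ} (hf : Measurable f) {x : X} (hx : x ∈ ⋃ n, D n) :
    ∀ᶠ k in atTop, x ∈ (bddExhaustion hD hf k).1 := by
  obtain ⟨n, hn⟩ := Set.mem_iUnion.1 hx
  obtain ⟨m, hm⟩ := exists_nat_ge |f x|
  filter_upwards [eventually_ge_atTop m, eventually_gt_atTop n] with k hk1 hk2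
  exact ⟨Set.mem_biUnion (Finset.mem_coe.2 (Finset.mem_range.2 hk2)) hn,
    hm.trans (by exact_mod_cast hk1)⟩

theorem aecover_bddExhaustion [OpensMeasurableSpace X] {D : ℕ → Set X}
    (hD : ∀ n, IsRelCompactBorel (D n)) {f : X → ℝ} (hf : Measurable f) {μ : Measure X}
    (hμ : μ (⋃ n, D n)ᶜ = 0) : AECover μ atTop fun k => (bddExhaustion hD hf k).1 where
  ae_eventually_mem := by
    have : ∀ᵐ x ∂μ, x ∈ ⋃ n, D n := hμ
    filter_upwards [this] with x hx using eventually_mem_bddExhaustion hD hf hx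
  measurableSet k := (bddExhaustion hD hf k).2.1.1

variable [Fact (1 ≤ q)]

theorem tendsto_toLp_indicator_bddSets (hq : q ≠ ∞) {D : ℕ → Set X}
    (hD : ∀ n, IsRelCompactBorel (D n)) (hDζ : ζ (⋃ n, D n)ᶜ = 0) {f : X → ℝ}
    (hfm : Measurable f) (hf : MemLp f q ζ) :
    Tendsto (fun A : BddSets f => (hf.indicator A.2.1.1).toLp (A.1.indicator f)) atTop
      (𝓝 (hf.toLp f)) := by
  refine (Lp.tendsto_Lp_iff_tendsto_eLpNorm'' _ _ _ hf).2 ?_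
  have h1 : Tendsto (fun k => eLpNorm ((bddExhaustion hD hfm k).1.indicator f - f) q ζ) atTop
      (𝓝 0) := by
    refine tendsto_eLpNorm_sub_of_dominated (g := fun x => |f x|)
      (one_pos.trans_le (Fact.out : 1 ≤ q)).ne' hq
      (fun k => hfm.indicator (bddExhaustion hD hfm k).2.1.1) hfm hf.abs (fun k x => ?_) ?_
    · by_cases hx : x ∈ (bddExhaustion hD hfm k).1 <;> simp [hx]
    · have : ∀ᵐ x ∂ζ, x ∈ ⋃ n, D n := hDζ
      filter_upwards [this] with x hx
      refine tendsto_const_nhds.congr' ?_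
      filter_upwards [eventually_mem_bddExhaustion hD hfm hx] with k hk
      rw [Set.indicator_of_mem hk]
  rw [ENNReal.tendsto_nhds_zero] at h1 ⊢
  intro ε hε
  obtain ⟨k, hk⟩ := (h1 ε hε).exists
  filter_upwards [eventually_ge_atTop (bddExhaustion hD hfm k)] with A hA
  refine le_trans (eLpNorm_mono fun x => ?_) hk
  by_cases hx : x ∈ A.1
  · simp [hx]
  · have hx' : x ∉ (bddExhaustion hD hfm k).1 := fun h => hx (hA h)
    simp [hx, hx']

theorem tendsto_setIntegral_bddSets {D : ℕ → Set X} [OpensMeasurableSpace X]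
    (hD : ∀ n, IsRelCompactBorel (D n)) {μ : Measure X} (hμ : μ (⋃ n, D n)ᶜ = 0) {f g : X → ℝ}
    (hf : Measurable f) (hg : Integrable g μ) (hg0 : ∀ x, 0 ≤ g x) :
    Tendsto (fun A : BddSets f => ∫ x in A.1, g x ∂μ) atTop (𝓝 (∫ x, g x ∂μ)) := by
  have h1 := (aecover_bddExhaustion hD hf hμ).integral_tendsto_of_countably_generated hg
  refine tendsto_order.2 ⟨fun a ha => ?_, fun a ha => Eventually.of_forall fun A => ?_⟩
  · obtain ⟨k, hk⟩ := ((tendsto_order.1 h1).1 a ha).exists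
    filter_upwards [eventually_ge_atTop (bddExhaustion hD hf k)] with A hA
    exact hk.trans_le (setIntegral_mono_set hg.integrableOn
      (Eventually.of_forall hg0) (Eventually.of_forall hA))
  · exact (setIntegral_le_integral hg (Eventually.of_forall hg0)).trans_lt ha

variable [IsLocallyFiniteMeasure ζ] {Ω : Type*} [MeasurableSpace Ω] {P : Measure Ω}
  [IsProbabilityMeasure P]
  {L : ℝ≥0 → Lp ℝ q ζ →ₗ[ℝ] (Ω →ₘ[P] ℝ)} {Ψ : Lp ℝ q ζ → ℂ} {c : Characteristics X}

theorem HasIndicatorForm.hasSymbolForm [OpensMeasurableSpace X] (h : HasIndicatorForm ζ Ψ c)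
    (hq : q ≠ ∞) (hc : Continuous Ψ) (hs : IsIndependentlyScattered P ζ q L)
    (hΨ : IsSymbol P ζ q L Ψ) {D : ℕ → Set X} (hD : ∀ n, IsRelCompactBorel (D n)) (hDζ : ζ (⋃ n, D n)ᶜ = 0)
    (hDG : c.gaussian (⋃ n, D n)ᶜ = 0) : HasSymbolForm ζ q c Ψ := by
  intro f hfm hf
  have hform : ∀ A : BddSets f, Ψ ((hf.indicator A.2.1.1).toLp _) = c.localForm A.2.1 f
      - 1 / 2 * ((∫ x in A.1, f x ^ 2 ∂c.gaussian : ℝ) : ℂ) := fun A =>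
    h.apply_bounded hq hc hs hΨ A.2.1 hfm A.2.2.choose_spec _
  have hlim := (hc.tendsto _).comp (tendsto_toLp_indicator_bddSets hq hD hDζ hfm hf)
  have hle : ∀ A : BddSets f, ∫ x in A.1, f x ^ 2 ∂c.gaussian ≤
      -2 * (Ψ ((hf.indicator A.2.1.1).toLp _)).re := by
    intro A
    have h1 := c.re_localForm_nonpos A.2.1 hfm A.2.2.choose_spec
    have h2 := congrArg Complex.re (hform A)
    have h3 : (1 / 2 * ((∫ x in A.1, f x ^ 2 ∂c.gaussian : ℝ) : ℂ)).re =
        1 / 2 * ∫ x in A.1, f x ^ 2 ∂c.gaussian := by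
      rw [Complex.re_mul_ofReal]
      norm_num
    rw [Complex.sub_re, h3] at h2
    linarith
  have hint : Integrable (fun x => f x ^ 2) c.gaussian := by
    have hre : Tendsto (fun A : BddSets f => -2 * (Ψ ((hf.indicator A.2.1.1).toLp _)).re) atTop
        (𝓝 (-2 * (Ψ (hf.toLp f)).re)) :=
      ((Complex.continuous_re.tendsto _).comp hlim).const_mul _
    obtain ⟨A₀, hA₀⟩ := eventually_atTop.1
      ((tendsto_order.1 hre).2 (-2 * (Ψ (hf.toLp f)).re + 1) (by linarith))
    refine (aecover_bddExhaustion hD hfm hDG).integrable_of_integral_bounded_of_nonneg_ae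
      (-2 * (Ψ (hf.toLp f)).re + 1) (fun k => c.integrableOn_sq (bddExhaustion hD hfm k).2.1 hfm
        (bddExhaustion hD hfm k).2.2.choose_spec) (Eventually.of_forall fun x => sq_nonneg _)
      (Eventually.of_forall fun k => ?_)
    obtain ⟨B, hB1, hB2⟩ := exists_ge_ge A₀ (bddExhaustion hD hfm k)
    refine le_trans (setIntegral_mono_set (c.integrableOn_sq B.2.1 hfm B.2.2.choose_spec)
      (Eventually.of_forall fun x => sq_nonneg _) (Eventually.of_forall hB2)) ?_
    exact (hle B).trans (hA₀ B hB1).le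
  refine ⟨hint, Ψ (hf.toLp f) + 1 / 2 * ((∫ x, f x ^ 2 ∂c.gaussian : ℝ) : ℂ), ?_, by ring⟩
  have h1 := (Complex.continuous_ofReal.tendsto _).comp
    (tendsto_setIntegral_bddSets hD hDG hfm hint fun x => sq_nonneg (f x))
  refine (hlim.add (h1.const_mul (1 / 2))).congr fun A => ?_
  simp only [Function.comp_apply]
  rw [hform A, sub_add_cancel]
  rfl

theorem IsIndependentlyScattered.exists_hasSymbolForm [OpensMeasurableSpace X]
    (hs : IsIndependentlyScattered P ζ q L) (hΨ : IsSymbol P ζ q L Ψ) (hc : Continuous Ψ)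
    (hq : q ≠ ∞) {D : ℕ → Set X} (hD : ∀ n, IsRelCompactBorel (D n))
    (hDd : Pairwise fun i j => Disjoint (D i) (D j)) (hDζ : ζ (⋃ n, D n)ᶜ = 0) :
    ∃ c : Characteristics X, HasSymbolForm ζ q c Ψ := by
  obtain ⟨M, γ, h⟩ := hs.exists_isKhintchineField hΨ hc
  obtain ⟨c, hG, hcf⟩ := h.exists_characteristics hq hc hΨ.apply_zero hD hDd hDζ
  exact ⟨c, hcf.hasSymbolForm hq hc hs hΨ hD hDζ hG⟩

end General

/-- A locally finite measure on a Borel subset of a proper metric space is concentrated on a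
countable union of disjoint relatively compact sets. -/
theorem exists_disjoint_isRelCompactBorel {E : Type*} [MetricSpace E] [ProperSpace E]
    [MeasurableSpace E] [BorelSpace E] {O : Set E} (hO : MeasurableSet O) (ζ : Measure O)
    [IsLocallyFiniteMeasure ζ] : ∃ D : ℕ → Set O, (∀ n, IsRelCompactBorel (D n)) ∧
      (Pairwise fun i j => Disjoint (D i) (D j)) ∧ ζ (⋃ n, D n)ᶜ = 0 := by
  have : SecondCountableTopology E := secondCountable_of_proper
  set η : Measure E := ζ.toFinite.map Subtype.val with hη
  have hex : ∀ n : ℕ, ∃ K ⊆ O, IsCompact K ∧ η (O \ K) < ((n : ℝ≥0∞) + 1)⁻¹ := fun n =>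
    hO.exists_isCompact_sdiff_lt (measure_ne_top η O) (by simp)
  choose K hKO hK hKη using hex
  have hKr : ∀ n, IsRelCompactBorel (Subtype.val ⁻¹' K n : Set O) := by
    intro n
    have h1 : IsCompact (Subtype.val ⁻¹' K n : Set O) := by
      rw [Subtype.isCompact_iff, Subtype.image_preimage_coe, Set.inter_eq_right.2 (hKO n)]
      exact hK n
    exact ⟨h1.measurableSet, by rwa [h1.isClosed.closure_eq]⟩
  refine ⟨disjointed fun n => Subtype.val ⁻¹' K n, fun n => ?_, fun i j hij =>
    disjoint_disjointed _ hij, ?_⟩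
  · exact (hKr n).mono (MeasurableSet.disjointed (fun k => (hKr k).1) n) (disjointed_subset _ n)
  · rw [iUnion_disjointed]
    refine absolutelyContinuous_toFinite ζ ?_
    refine le_antisymm (ge_of_tendsto' (x := atTop) (f := fun n : ℕ => ((n : ℝ≥0∞) + 1)⁻¹) ?_
      fun n => ?_) zero_le
    · have := (ENNReal.tendsto_inv_nat_nhds_zero).comp (tendsto_add_atTop_nat 1)
      refine this.congr fun n => ?_
      simp
    · refine le_trans ?_ (hKη n).le
      rw [hη, Measure.map_apply measurable_subtype_coe (hO.diff (hK n).measurableSet)]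
      refine measure_mono fun x hx => ⟨x.2, fun h => hx (Set.mem_iUnion.2 ⟨n, h⟩)⟩

end CylLevy

theorem mainTheorem3 {Ω : Type*} [MeasurableSpace Ω] (P : MeasureTheory.Measure Ω)
    [MeasureTheory.IsProbabilityMeasure P]
    {d : ℕ} (O : Set (EuclideanSpace ℝ (Fin d))) (hO : MeasurableSet O)
    (ζ : MeasureTheory.Measure O) [MeasureTheory.IsLocallyFiniteMeasure ζ]
    (p q : ℝ≥0∞) [ENNReal.HolderConjugate p q] [Fact (1 ≤ q)] (hp : p ≠ ∞)
    (L : ℝ≥0 → MeasureTheory.Lp ℝ q ζ →ₗ[ℝ] (Ω →ₘ[P] ℝ))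
    (hL : CylLevy.IsCylindricalLevyProcess P ζ q L) :
    (1 < p →
      (CylLevy.IsIndependentlyScattered P ζ q L ↔
        ∃ (c : CylLevy.Characteristics O) (Ψ : MeasureTheory.Lp ℝ q ζ → ℂ),
          CylLevy.IsSymbol P ζ q L Ψ ∧ CylLevy.HasSymbolForm ζ q c Ψ)) ∧
    ((∃ (c : CylLevy.Characteristics O) (Ψ : MeasureTheory.Lp ℝ q ζ → ℂ),
          CylLevy.IsSymbol P ζ q L Ψ ∧ CylLevy.HasSymbolForm ζ q c Ψ) →
      CylLevy.IsIndependentlyScattered P ζ q L) := by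
  have hconv : (∃ (c : CylLevy.Characteristics O) (Ψ : MeasureTheory.Lp ℝ q ζ → ℂ),
      CylLevy.IsSymbol P ζ q L Ψ ∧ CylLevy.HasSymbolForm ζ q c Ψ) →
      CylLevy.IsIndependentlyScattered P ζ q L := by
    rintro ⟨c, Ψ, hΨ, h⟩
    exact CylLevy.isIndependentlyScattered_of_hasSymbolForm hΨ h
  refine ⟨fun hp1 => ⟨fun hs => ?_, hconv⟩, hconv⟩
  have hq : q ≠ ∞ := by
    have : ENNReal.HolderConjugate q p := inferInstance
    exact (ENNReal.HolderConjugate.ne_top_iff_ne_one q p).2 hp1.ne'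
  obtain ⟨Ψ, hΨ⟩ := hL.exists_isSymbol
  obtain ⟨D, hD, hDd, hDζ⟩ := CylLevy.exists_disjoint_isRelCompactBorel hO ζ
  obtain ⟨c, hc⟩ := hs.exists_hasSymbolForm hΨ (hL.continuous_symbol hΨ) hq hD hDd hDζ
  exact ⟨c, Ψ, hΨ, hc⟩
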